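/- **Setting.** An *involution channel* is given by two strictly increasing concave functions $\bar\delta_\uparrow:(-\bar\delta_\downarrow^\infty,\infty)\to\mathbb R$ and $\bar\delta_\downarrow:(-\bar\delta_\uparrow^\infty,\infty)\to\mathbb R$ with finite limits $\bar\delta_\uparrow^\infty,\bar\delta_\downarrow^\infty$ at $\infty$ (also written $\bar\delta_{\uparrow/\downarrow}(\infty)$) and $-\bar\delta_\uparrow(-\bar\delta_\downarrow(T))=T$, $-\bar\delta_\downarrow(-\bar\delta_\uparrow(T))=T$ on the respective domains. It is *strictly causal* if $\bar\delta_\uparrow(0)$ and $\bar\delta_\downarrow(0)$ are defined and positive. A *WST signal* is a finite or infinite sequence $(t_n,x_n)_{n\ge0}$ with $t_0=-\infty$, $x_n\in\{0,1\}$ alternating, and $t_n$ strictly increasing and unbounded if the sequence is infinite. A *TCT signal* is a sequence $(t_n,x_n,o_n)_{n\ge 0}$ such that $(t_n,x_n)$ is a WST signal, $o_n\in\mathbb R\cup\{-\infty\}$, $o_0=0$, and the occurrence times $t_n'=t_n+o_n$ satisfy $t'_{n-2}\le t'_n$. Transition $n$ cancels transition $n-1$ if $t_n'\le t_{n-1}'$.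 The state of a signal at time $t$ is the value of its most recent (not canceled) transition occurring at or before $t$. A *CIDM channel* $C$ consists of a $d$-ary Boolean gate $G$, for each input $I$ a pure delay shifter with delays $\Delta_I^+,\Delta_I^-\in\mathbb R$, and an involution channel $\bar\delta_{\uparrow/\downarrow}$. The shifter adds $\Delta_I^+$ ($\Delta_I^-$) to the offsets of rising (falling) transitions, with the two interchanged if $G$ is an inverter; if $G$ is neither an inverter nor a buffer, $\Delta_I^+=\Delta_I^-$ is required. For TCT input signals the channel function yields the following TCT output signal: the gate output is the WST signal that has the fixed initial value $Init(C)$ until time $0$ and, at every $t\ge0$, the value of $G$ on the states of the shifted input signals; its initial transition is given offset $0$, and its $n$-th transition $(t_n,x_n)$, $n\ge1$, is given the offset $\bar\delta_{\uparrow}(t_n-t_{n-1}')$ if $x_n=1$ and $\bar\delta_\downarrow(t_n-t'_{n-1})$ if $x_n=0$. A *circuit* has finitely many input ports and channels, and output ports; every channel input and every output port is fed by exactly one input port or channel, and input ports and channels $\Gamma$ have fixed initial values $Init(\Gamma)$. An *execution* assigns a TCT signal to every vertex such that every channel's signal is its channel function applied to the signals of the vertices feeding it, and every output port has the signal of the vertex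 feeding it. The channels are *compatible* if for every edge from a channel to an input of a channel the logical channel (the involution channel of the former followed by the shifter at that input of the latter, which is again an involution channel) is strictly causal. The externally supplied input port signals are TCT signals with initial values $Init(i)$, transitions $n\ge1$ at times $t_n\ge0$, and they are causal at every channel input they feed: if $p_n$ denotes the occurrence times behind the shifter there, then for all $n\ge1$ either $t_n\le p_n$, or $p_n\le p_{n-1}$ and $t_n\le p_{n-1}$. (This holds, e.g., if all offsets and shifts are $0$.) **Simulation algorithm** with horizon $\tau$. It maintains a file $F(\Gamma)$ of transitions for every input port and channel, and two-valued simulator signals $evTI(\Gamma,I,C)$ and $evGI(I,C)$ for every edge $(\Gamma,I,C)$ into a channel and $evGO(C)$ for every channel. Scheduling a transition of such a signal for time $t$ deletes its transitions already scheduled for times $\ge t$; a scheduled transition that does not change the value of its signal triggers no event; the value of a signal at the current time $t$ takes transitions scheduled for $t$ into account. Initially $F(\Gamma)=((-\infty,Init(\Gamma),0))$, $evTI=0$, $evGI(I,C)=Init(\Gamma)$ for the vertex $\Gamma$ feeding $I$, $evGO(C)=Init(C)$, and $evGO(C)$ is scheduled to change at time $0$ if the gate value on the initial inputs differs from $Init(C)$.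 While the earliest scheduled event has time $t\le\tau$, it is processed; at equal times new external transitions of input ports come first, then $evTI$, then $evGI$, then $evGO$, and remaining ties are broken arbitrarily: - a new external transition of input port $i$ is appended to $F(i)$ and $evTI(i,I,C)$ is toggled at time $t$ on all edges $(i,I,C)$; - $evTI(\Gamma,I,C)$: with $(t_\ast,x,o)$ the last entry of $F(\Gamma)$, schedule $evGI(I,C)$ to become $x$ at time $\max\{t,t_\ast+o+\delta\}$, where $\delta$ is $\Delta_I^+$ or $\Delta_I^-$ according to $x$ (interchanged for an inverter); - $evGI(I,C)$: if the gate value on the current values of $evGI(\cdot,C)$ differs from the value of $evGO(C)$, schedule $evGO(C)$ to take that value at time $t$; - $evGO(C)$ with new value $x$: with $t'$ the occurrence time of the last entry of $F(C)$ and $T=t-t'$, append $(t,x,o)$ to $F(C)$, where $o=\delta_\uparrow(T-\Delta^+)-\Delta^+$ if $x=1$ and $o=\delta_\downarrow(T-\Delta^-)-\Delta^-$ if $x=0$; here $\delta_\uparrow(T)=\Delta^++\bar\delta_\uparrow(T+\Delta^+)$, $\delta_\downarrow(T)=\Delta^-+\bar\delta_\downarrow(T+\Delta^-)$ are the delay functions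 of the channel characterized with a pair $(\Delta^+,\Delta^-)$; and toggle $evTI(C,I,C')$ at time $t$ on all outgoing edges. **Theorem 3 (Correctness of simulation).** For every circuit with compatible CIDM channels, all input port signals as above and every $0\le\tau<\infty$, every run of the simulation algorithm terminates. There is exactly one execution of the circuit with the given input port signals, and when a run has terminated, the file of every input port and channel (for an output port: the file of the vertex feeding it) consists exactly of the transitions of that execution's signal with scheduled time at most $\tau$, in order. -/

import Mathlib

open Set Filter Topology

noncomputable section

namespace CIDM

/-! ### Involution channels

Directions of transitions are Booleans: `true` is rising (`1`), `false` is falling (`0`). -/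

/-- The delay functions of an involution channel. `δ true` is `δ↑` and `δ false` is `δ↓`; they are
only meaningful on their domains `(-δ↓∞, ∞)` and `(-δ↑∞, ∞)`. `lim x` is the finite limit `δ∞` of
`δ x`. -/
structure Involution where
  δ : Bool → ℝ → ℝ
  lim : Bool → ℝ
  strictMono : ∀ x, StrictMonoOn (δ x) (Ioi (-lim (!x)))
  concave : ∀ x, ConcaveOn ℝ (Ioi (-lim (!x))) (δ x)
  tendsto_lim : ∀ x, Tendsto (δ x) atTop (𝓝 (lim x))
  involution : ∀ x T, -lim (!x) < T → -δ (!x) (-δ x T) = T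

/-- Strict causality: `δ↑(0)` and `δ↓(0)` are defined and positive. -/
def Involution.StrictlyCausal (c : Involution) : Prop :=
  ∀ x, 0 ∈ Ioi (-c.lim (!x)) ∧ 0 < c.δ x 0

/-- The delay functions extended to `T = ∞` by their limits. -/
def Involution.delay (c : Involution) (x : Bool) : WithTop ℝ → ℝ
  | ⊤ => c.lim x
  | (T : ℝ) => c.δ x T

/-- The involution channel `c` followed by a pure delay shifter that delays rising transitions by
`a true` and falling ones by `a false`; this is again an involution channel. -/
def Involution.thenShift (c : Involution) (a : Bool → ℝ) : Involution where
  δ x T := a x + c.δ x (T + a (!x))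
  lim x := a x + c.lim x
  strictMono x := by
    intro S hS T hT hST
    simp only [mem_Ioi] at hS hT
    have := c.strictMono x (a := S + a (!x)) (b := T + a (!x))
      (by simp only [mem_Ioi]; linarith) (by simp only [mem_Ioi]; linarith) (by linarith)
    simp only
    linarith
  concave x := by
    have h := (c.concave x).translate_left (a (!x))
    have h2 := (concaveOn_const (𝕜 := ℝ) (a x) h.1).add h
    have hs : (fun z => a (!x) + z) ⁻¹' Ioi (-c.lim (!x)) = Ioi (-(a (!x) + c.lim (!x))) := by
      ext z; simp only [mem_preimage, mem_Ioi]; constructor <;> intro h <;> linarith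
    rw [hs] at h2
    exact h2
  tendsto_lim x :=
    tendsto_const_nhds.add ((c.tendsto_lim x).comp (tendsto_atTop_add_const_right _ _ tendsto_id))
  involution x T hT := by
    have h := c.involution x (T + a (!x)) (by linarith)
    have e : -(a x + c.δ x (T + a (!x))) + a (!!x) = -c.δ x (T + a (!x)) := by
      rw [Bool.not_not]; ring
    rw [e]
    linarith

/-! ### Signals

Both kinds of signals are finite or infinite sequences. Times and offsets live in `ℝ ∪ {-∞}`. -/

/-- The time elapsed at time `t` since `t'`; it is `∞` if `t' = -∞`. -/
def elapsed (t : ℝ) : WithBot ℝ → WithTop ℝ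
  | ⊥ => ⊤
  | (t' : ℝ) => ((t - t' : ℝ) : WithTop ℝ)

/-- Sequences of transitions `(t, x)`. -/
abbrev WSTSeq := Stream'.Seq (WithBot ℝ × Bool)

/-- The conditions for a sequence of transitions to be a WST signal. -/
structure IsWST (w : WSTSeq) : Prop where
  initial : ∃ x, w.get? 0 = some (⊥, x)
  alternating : ∀ n a b, w.get? n = some a → w.get? (n + 1) = some b → b.2 = !a.2
  increasing : ∀ n a b, w.get? n = some a → w.get? (n + 1) = some b → a.1 < b.1
  unbounded : (∀ n, w.get? n ≠ none) → ∀ L : ℝ, ∃ n a, w.get? n = some a ∧ (L : WithBot ℝ) < a.1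

/-- The state function of `w` has value `v` at time `t`: the most recent transition before or at
`t` is to `v`. -/
def WSTState (w : WSTSeq) (t : ℝ) (v : Bool) : Prop :=
  ∃ n s, w.get? n = some (s, v) ∧ s ≤ t ∧ ∀ m > n, ∀ b, w.get? m = some b → (t : WithBot ℝ) < b.1

/-- A transition `(t, x, o)`: scheduled at time `t`, in direction `x`, with offset `o`. -/
structure Transition where
  t : WithBot ℝ
  x : Bool
  o : WithBot ℝ

/-- The time at which a transition actually occurs. -/
def Transition.occ (a : Transition) : WithBot ℝ := a.t + a.o

/-- Sequences of transitions `(t, x, o)`. -/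
abbrev TCTSeq := Stream'.Seq Transition

/-- Forgetting the offsets. -/
def TCTSeq.scheduled (s : TCTSeq) : WSTSeq := s.map fun a => (a.t, a.x)

/-- The conditions for a sequence of transitions with offsets to be a TCT signal. -/
structure IsTCT (s : TCTSeq) : Prop where
  wst : IsWST (TCTSeq.scheduled s)
  offset_zero : ∀ a, s.get? 0 = some a → a.o = 0
  occ_le : ∀ n a b, s.get? n = some a → s.get? (n + 2) = some b → a.occ ≤ b.occ

/-- Transition `n` of `s` is canceled by its successor. -/
def Canceled (s : TCTSeq) (n : ℕ) : Prop :=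
  ∃ a b, s.get? n = some a ∧ s.get? (n + 1) = some b ∧ b.occ ≤ a.occ

/-- The state function of `s` has value `v` at time `t`: this is the value of the most recent not
canceled transition occurring before or at `t`. As a transition that cancels its predecessor may
repeat the value of an earlier transition, even infinitely often before time `t`, "most recent" is
expressed by: some such transition has value `v`, and so have all later ones. -/
def TCTState (s : TCTSeq) (t : ℝ) (v : Bool) : Prop :=
  ∃ n a, s.get? n = some a ∧ a.occ ≤ t ∧ ¬ Canceled s n ∧ a.x = v ∧
    ∀ m > n, ∀ b, s.get? m = some b → b.occ ≤ t → ¬ Canceled s m → b.x = v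

/-- The pure delay shifter: it adds `a x` to the offset of every transition in direction `x`. -/
def shifter (a : Bool → ℝ) (s : TCTSeq) : TCTSeq :=
  s.map fun b => ⟨b.t, b.x, b.o + (a b.x : WithBot ℝ)⟩

/-! ### CIDM channels -/

/-- A CIDM channel that embeds a `d`-ary gate with Boolean function `f`. -/
structure Channel where
  /-- The arity of the embedded gate. -/
  d : ℕ
  /-- The Boolean function of the embedded gate. -/
  f : (Fin d → Bool) → Bool
  /-- The pair `(Δ⁺, Δ⁻)` of the pure delay shifter at each input. -/
  Δ : Fin d → Bool → ℝ
  /-- The involution channel behind the gate. -/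
  inv : Involution
  /-- The pair `(Δ⁺, Δ⁻)` with respect to which the delay functions of the whole channel, from its
  input to its output, are tabulated. -/
  Δchar : Bool → ℝ

namespace Channel

/-- The gate is an inverter. -/
def IsNot (C : Channel) : Prop := C.d = 1 ∧ ∀ v I, C.f v = !(v I)

/-- The gate is a buffer. -/
def IsId (C : Channel) : Prop := C.d = 1 ∧ ∀ v I, C.f v = v I

/-- Delays may depend on the direction only for inverters and buffers. -/
def Supported (C : Channel) : Prop :=
  ¬ C.IsNot → ¬ C.IsId → ∀ I, C.Δ I true = C.Δ I false

open Classical in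
/-- The delay that the shifter at input `I` adds to input transitions in direction `x`. As
`Δ⁺` and `Δ⁻` refer to the directions of the resulting transitions behind the gate, they are
interchanged at an inverter. -/
def inShift (C : Channel) (I : Fin C.d) (x : Bool) : ℝ :=
  if C.IsNot then C.Δ I (!x) else C.Δ I x

/-- The delay functions of the channel from its input to its output, i.e. of a pure delay shifter
`Δchar` followed by the involution channel. -/
def delay (C : Channel) (x : Bool) (T : WithTop ℝ) : ℝ :=
  C.Δchar x + C.inv.delay x (T + (C.Δchar x : WithTop ℝ))

/-- `ug` is the output of the gate with initial value `x₀` if its inputs are the signals that the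
cancellation units produce from `up`. The initial value is kept until the reset is released at
time `0`. -/
structure IsGateOutput (C : Channel) (x₀ : Bool) (up : Fin C.d → TCTSeq) (ug : WSTSeq) : Prop where
  wst : IsWST ug
  initial : ug.get? 0 = some (⊥, x₀)
  nonneg : ∀ n a, ug.get? (n + 1) = some a → ((0 : ℝ) : WithBot ℝ) ≤ a.1
  state : ∀ t : ℝ, 0 ≤ t →
    ∃ v : Fin C.d → Bool, (∀ I, TCTState (up I) t (v I)) ∧ WSTState ug t (C.f v)

/-- `s` is the output of the involution channel for the input `ug`: the transition of `ug` at time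
`t` occurs at the output with delay `δ(t - t')`, where `t'` is the time at which the preceding
transition occurs at the output. -/
structure IsDelayOutput (C : Channel) (ug : WSTSeq) (s : TCTSeq) : Prop where
  scheduled : TCTSeq.scheduled s = ug
  offset_zero : ∀ a, s.get? 0 = some a → a.o = 0
  offset : ∀ n a b (t : ℝ), s.get? n = some a → s.get? (n + 1) = some b → b.t = t →
    b.o = (C.inv.delay b.x (elapsed t a.occ) : ℝ)

/-- The graph of the channel function: `s` is the output of the channel `C` with initial value `x₀`
for the input signals `ui`. -/
def Maps (C : Channel) (x₀ : Bool) (ui : Fin C.d → TCTSeq) (s : TCTSeq) : Prop :=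
  ∃ ug, C.IsGateOutput x₀ (fun I => shifter (C.inShift I) (ui I)) ug ∧ C.IsDelayOutput ug s

end Channel

/-! ### Circuits and executions -/

/-- The vertices of a circuit. -/
inductive Vertex (Inp Out Chan : Type*) where
  | inp (i : Inp)
  | out (o : Out)
  | chan (C : Chan)

/-- A circuit with input ports `Inp`, output ports `Out` and channels `Chan`. Every channel input
and every output port is fed by exactly one input port or channel. -/
structure Circuit (Inp Out Chan : Type*) where
  channel : Chan → Channel
  /-- The vertex that feeds an input of a channel. -/
  src : (Σ C, Fin (channel C).d) → Inp ⊕ Chan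
  /-- The vertex that feeds an output port. -/
  outSrc : Out → Inp ⊕ Chan
  /-- The initial values of input ports and channels. -/
  init : Inp ⊕ Chan → Bool

namespace Circuit

variable {Inp Out Chan : Type*} (N : Circuit Inp Out Chan)

/-- The channel inputs, i.e. the heads of the edges that lead to channels. -/
abbrev Pin : Type _ := Σ C, Fin (N.channel C).d

/-- Input ports and channels as vertices. -/
def toVertex : Inp ⊕ Chan → Vertex Inp Out Chan
  | .inl i => .inp i
  | .inr C => .chan C

/-- The delays of the shifter at a channel input. -/
def pinShift (p : N.Pin) : Bool → ℝ := (N.channel p.1).inShift p.2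

/-- The logical channel between a channel `C` and a channel input `p` fed by `C`. -/
def logical (C : Chan) (p : N.Pin) : Involution :=
  (N.channel C).inv.thenShift (N.pinShift p)

/-- Interconnected channels are compatible: all logical channels are strictly causal. -/
def Compatible : Prop :=
  ∀ (p : N.Pin) (C : Chan), N.src p = .inr C → (N.logical C p).StrictlyCausal

/-- All channels are supported by the simulation algorithm. -/
def Supported : Prop := ∀ C, (N.channel C).Supported

/-- A collection of signals for all vertices is an execution. -/
structure IsExecution (E : Vertex Inp Out Chan → TCTSeq) : Prop where
  tct : ∀ Γ, IsTCT (E Γ)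
  out : ∀ o, E (.out o) = E (toVertex (N.outSrc o))
  chan : ∀ C, (N.channel C).Maps (N.init (.inr C))
    (fun I => E (toVertex (N.src ⟨C, I⟩))) (E (.chan C))

/-- Admissible external signals: TCT signals with the prescribed initial values and all further
transitions scheduled at times `≥ 0`, which are causal at the channel inputs they are connected to:
behind the shifter, a transition occurs before the time it is scheduled at only if it cancels a
transition that has not occurred before that time. -/
structure AdmissibleInput (u : Inp → TCTSeq) : Prop where
  tct : ∀ i, IsTCT (u i)
  init : ∀ i a, (u i).get? 0 = some a → a.x = N.init (.inl i)
  nonneg : ∀ i n a, (u i).get? (n + 1) = some a → ((0 : ℝ) : WithBot ℝ) ≤ a.t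
  causal : ∀ (p : N.Pin) (i : Inp), N.src p = .inl i → ∀ n a b,
    (shifter (N.pinShift p) (u i)).get? n = some a →
    (shifter (N.pinShift p) (u i)).get? (n + 1) = some b →
    b.t ≤ b.occ ∨ (b.occ ≤ a.occ ∧ b.t ≤ a.occ)

end Circuit

/-! ### The simulation algorithm -/

/-- A signal of the event-driven simulator: its current value and the transitions scheduled for it,
in the order of their times. -/
structure Driver where
  cur : Bool
  pend : List (ℝ × Bool)

namespace Driver

open Classical in
/-- `sched(ev, (t, x))`. The new transition replaces those already scheduled for time `t` and cancels
those scheduled for later times. -/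
def sched (D : Driver) (t : ℝ) (x : Bool) : Driver :=
  ⟨D.cur, D.pend.filter (fun e => e.1 < t) ++ [(t, x)]⟩

/-- `sched(ev, (t, toggle))`. -/
def toggle (D : Driver) (t : ℝ) : Driver :=
  D.sched t (!((D.pend.getLast?.map Prod.snd).getD D.cur))

open Classical in
/-- `s(ev, t)` for `t` not in the past: the value of the last transition that has occurred or is
scheduled before or at `t`. -/
def value (D : Driver) (t : ℝ) : Bool :=
  ((D.pend.filter (fun e => e.1 ≤ t)).getLast?.map Prod.snd).getD D.cur

/-- The next scheduled transition takes place. -/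
def advance (D : Driver) : Driver :=
  match D.pend with
  | [] => D
  | (_, x) :: l => ⟨x, l⟩

end Driver

namespace Circuit

variable {Inp Out Chan : Type*} (N : Circuit Inp Out Chan)

/-- The state of the simulation: the files `F(Γ)`, in chronological order, and the signals
`evTI(Γ, I, C)`, `evGI(I, C)` and `evGO(C)`. -/
structure SimState where
  F : Inp ⊕ Chan → List Transition
  ti : N.Pin → Driver
  gi : N.Pin → Driver
  go : Chan → Driver

/-- The events: a new external transition at an input port, `evTI(Γ, I, C)`, `evGI(I, C)` and
`evGO(C)`. -/
inductive Event where
  | ext (i : Inp)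
  | ti (p : N.Pin)
  | gi (p : N.Pin)
  | go (C : Chan)

/-- The order in which events scheduled for the same time occur. -/
def Event.rank : N.Event → ℕ
  | .ext _ => 0
  | .ti _ => 1
  | .gi _ => 2
  | .go _ => 3

/-- The procedure `calcDelta` for the gate of the channel `C`. -/
def calcDelta (C : Channel) (x : Bool) (Δp Δm : ℝ) : ℝ :=
  open Classical in
  if C.IsNot then (if x = true then Δm else Δp)
  else if C.IsId then (if x = true then Δp else Δm)
  else Δp

variable {N}

open Classical in
/-- Initialization: the initial state at time `-∞` and the reset transitions at time `0`. -/
def initState (N : Circuit Inp Out Chan) : N.SimState :=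
  let gi : N.Pin → Driver := fun p => ⟨N.init (N.src p), []⟩
  { F := fun Γ => [⟨⊥, N.init Γ, 0⟩]
    ti := fun _ => ⟨false, []⟩
    gi := gi
    go := fun C =>
      let D : Driver := ⟨N.init (.inr C), []⟩
      let x := (N.channel C).f fun I => (gi ⟨C, I⟩).value 0
      if x ≠ N.init (.inr C) then D.sched 0 x else D }

open Classical in
/-- A new transition is added to `F(Γ)`, and the transition indicators of all edges that leave `Γ`
are toggled. -/
def SimState.emit (st : N.SimState) (Γ : Inp ⊕ Chan) (t : ℝ) (a : Transition) : N.SimState :=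
  { st with
    F := Function.update st.F Γ (st.F Γ ++ [a])
    ti := fun p => if N.src p = Γ then (st.ti p).toggle t else st.ti p }

/-- Processing of `evTI(Γ, I, C)` at time `t`. -/
def SimState.procTI (st : N.SimState) (p : N.Pin) (t : ℝ) : N.SimState :=
  open Classical in
  match (st.F (N.src p)).getLast? with
  | none => st
  | some a =>
    let C := N.channel p.1
    let δmin := calcDelta C a.x (C.Δ p.2 true) (C.Δ p.2 false)
    let t' : ℝ := match a.occ with
      | ⊥ => t
      | (r : ℝ) => max t (r + δmin)
    { st with gi := Function.update st.gi p ((st.gi p).sched t' a.x) }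

/-- Processing of `evGI(I, C)` at time `t`. -/
def SimState.procGI (st : N.SimState) (p : N.Pin) (t : ℝ) : N.SimState :=
  open Classical in
  let C := p.1
  let x := (st.go C).value t
  let y := (N.channel C).f fun I => (st.gi ⟨C, I⟩).value t
  if x ≠ y then { st with go := Function.update st.go C ((st.go C).sched t y) } else st

/-- Processing of `evGO(C)` with value `x` at time `t`. -/
def SimState.procGO (st : N.SimState) (C : Chan) (t : ℝ) (x : Bool) : N.SimState :=
  match (st.F (.inr C)).getLast? with
  | none => st
  | some a =>
    let Δ := (N.channel C).Δchar x
    let T := elapsed t a.occ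
    let o := (N.channel C).delay x (T + ((-Δ : ℝ) : WithTop ℝ)) - Δ
    st.emit (.inr C) t ⟨t, x, (o : ℝ)⟩

variable (N)

/-- The next occurrence of `ev` is scheduled for time `t`. The external signals `u` supply the next
transition of an input port. -/
def Due (u : Inp → TCTSeq) (st : N.SimState) : N.Event → ℝ → Prop
  | .ext i, t => ∃ a, (u i).get? (st.F (.inl i)).length = some a ∧ a.t = t
  | .ti p, t => (st.ti p).pend.head?.map Prod.fst = some t
  | .gi p, t => (st.gi p).pend.head?.map Prod.fst = some t
  | .go C, t => (st.go C).pend.head?.map Prod.fst = some t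

open Classical in
/-- The body of the main loop for the event `ev` at time `t`. A scheduled transition that does not
change the value of its signal is no event and triggers no processing. -/
def process (u : Inp → TCTSeq) (st : N.SimState) (ev : N.Event) (t : ℝ) : N.SimState :=
  match ev with
  | .ext i =>
    match (u i).get? (st.F (.inl i)).length with
    | none => st
    | some a => st.emit (.inl i) t a
  | .ti p =>
    let D := (st.ti p).advance
    let st' : N.SimState := { st with ti := Function.update st.ti p D }
    if D.cur ≠ (st.ti p).cur then st'.procTI p t else st'
  | .gi p =>
    let D := (st.gi p).advance
    let st' : N.SimState := { st with gi := Function.update st.gi p D }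
    if D.cur ≠ (st.gi p).cur then st'.procGI p t else st'
  | .go C =>
    let D := (st.go C).advance
    let st' : N.SimState := { st with go := Function.update st.go C D }
    if D.cur ≠ (st.go C).cur then st'.procGO C t D.cur else st'

/-- One iteration of the main loop with horizon `τ`. The event is any of those that come first in
the order by time and rank; the order of events that agree in both is left open. -/
def Step (u : Inp → TCTSeq) (τ : ℝ) (st st' : N.SimState) : Prop :=
  ∃ ev t, N.Due u st ev t ∧ t ≤ τ ∧
    (∀ ev' t', N.Due u st ev' t' → t < t' ∨ (t = t' ∧ ev.rank ≤ ev'.rank)) ∧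
    st' = N.process u st ev t

/-- The signals recorded by the simulation: the files of input ports and channels, and for an output
port the file of the vertex that feeds it. -/
def SimState.recorded {N : Circuit Inp Out Chan} (st : N.SimState) :
    Vertex Inp Out Chan → List Transition
  | .inp i => st.F (.inl i)
  | .out o => st.F (N.outSrc o)
  | .chan C => st.F (.inr C)

end Circuit

/-- The list `l` consists of exactly the transitions of `s` scheduled up to time `τ`, in order. -/
def IsUpTo (τ : ℝ) (s : TCTSeq) (l : List Transition) : Prop :=
  ∀ n a, l[n]? = some a ↔ s.get? n = some a ∧ a.t ≤ τ

end CIDM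

end

noncomputable section

namespace CIDM

/-! ### WST signals and their state functions -/

/-! Strict causality is an open condition on finitely many logical channels, so it holds with a
common margin: some `ε > 0` satisfies `ε ≤ δ(-ε)` for all of them
(`Circuit.Compatible.exists_margin`). By monotonicity of the delay functions, a channel transition
scheduled at time `t` then occurs behind the next shifter no earlier than `t + ε`, or it cancels a
predecessor that would itself not have occurred before `t + ε` (`Channel.IsDelayOutput.causal`).
Hence the state of such a signal at time `t` depends only on the transitions scheduled up to `t - ε`
(`PartState.tctState`). For external signals the same holds with `ε = 0`.

Executions are the fixed points of the map that applies all channels to a collection of signals. If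
two collections agree up to time `T`, their images agree up to `T + ε` (`Circuit.MapsTo.agreeUpTo`).
All candidates agree before time `0`, where nothing but the initial transitions is scheduled. So two
fixed points are equal, and the iterates of the map stabilize on every bounded stretch of time, with
a fixed point as limit (`Circuit.exists_fixedPoint`). The map is defined everywhere because input
states are step functions, so that the gate output is a WST signal, and because the involution
property keeps the channel output a TCT signal.

The simulation is compared with the fixed point `W`. Each file is a prefix of the signal in `W`,
complete before the current time, and `evGI` is planned as the transitions passed on so far dictate
(`PartState`): the deletions made by `sched` express that the latest transition in the sequence
wins. Thanks to `ε`, channel transitions scheduled right now cannot influence present input states,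
so after the external and `evTI` events of a time the signals `evGI` show the true states, and
`evGO` records exactly the next transition of `W`. Nothing is forgotten: if no event is left, the
earliest missing transition would be a switch of a gate whose inputs do not change
(`SimInv.lt_length`). Runs terminate because `W` has only finitely many transitions up to `τ`, and
between two recordings the pending events are used up in the order `evTI`, `evGI`, `evGO`. -/

theorem IsWST.lt_of_lt {w : WSTSeq} (hw : IsWST w) {n m : ℕ} (h : n < m) {a b}
    (ha : w.get? n = some a) (hb : w.get? m = some b) : a.1 < b.1 := by
  induction m, h using Nat.le_induction generalizing b with
  | base => exact hw.increasing n a b ha hb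
  | succ m hm ih =>
    obtain ⟨c, hc⟩ := w.ge_stable (Nat.le_succ m) hb
    exact (ih hc).trans (hw.increasing m c b hc hb)

/-- Only finitely many transitions are scheduled up to time `T`. -/
theorem IsWST.exists_count {w : WSTSeq} (hw : IsWST w) (T : ℝ) :
    ∃ k, 0 < k ∧ ∀ n a, w.get? n = some a → (a.1 ≤ (T : WithBot ℝ) ↔ n < k) := by
  classical
  have hex : ∃ n, ∀ a, w.get? n = some a → (T : WithBot ℝ) < a.1 := by
    by_cases h : ∀ n, w.get? n ≠ none
    · obtain ⟨n, a, ha, hT⟩ := hw.unbounded h T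
      refine ⟨n, fun b hb => ?_⟩
      rw [ha] at hb
      cases hb
      exact hT
    · push Not at h
      obtain ⟨n, hn⟩ := h
      exact ⟨n, fun a ha => by simp [hn] at ha⟩
  refine ⟨Nat.find hex, ?_, fun n a ha => ⟨fun h => ?_, fun h => ?_⟩⟩
  · by_contra h0
    have hz : Nat.find hex = 0 := by omega
    have := Nat.find_spec hex
    rw [hz] at this
    obtain ⟨x, hx⟩ := hw.initial
    simpa using this _ hx
  · by_contra hlt
    rw [not_lt] at hlt
    obtain ⟨b, hb⟩ := w.ge_stable hlt ha
    have h1 := Nat.find_spec hex b hb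
    rcases hlt.eq_or_lt with e | e
    · rw [e] at hb
      rw [ha] at hb
      cases hb
      exact absurd h1 (not_lt.2 h)
    · exact absurd (h1.trans (hw.lt_of_lt e hb ha)) (not_lt.2 h)
  · have := Nat.find_min hex h
    push Not at this
    obtain ⟨b, hb, hle⟩ := this
    rw [ha] at hb
    cases hb
    exact hle

theorem WSTState.unique {w : WSTSeq} {t : ℝ} {v v' : Bool} (h : WSTState w t v)
    (h' : WSTState w t v') : v = v' := by
  obtain ⟨n, s, hn, hs, hmax⟩ := h
  obtain ⟨n', s', hn', hs', hmax'⟩ := h'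
  rcases lt_trichotomy n n' with h | h | h
  · exact absurd (hmax _ h _ hn') (not_lt.2 hs')
  · subst h
    rw [hn] at hn'
    simp at hn'
    exact hn'.2
  · exact absurd (hmax' _ h _ hn) (not_lt.2 hs)

/-- The state between a transition and the next one. -/
theorem IsWST.state_of_next {w : WSTSeq} (hw : IsWST w) {n : ℕ} {a} {t : ℝ}
    (ha : w.get? n = some a) (hat : a.1 ≤ t)
    (hnext : ∀ b, w.get? (n + 1) = some b → (t : WithBot ℝ) < b.1) : WSTState w t a.2 := by
  refine ⟨n, a.1, ha, hat, fun m hm b hb => ?_⟩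
  obtain ⟨c, hc⟩ := w.ge_stable (Nat.succ_le_of_lt hm) hb
  rcases (Nat.succ_le_of_lt hm).eq_or_lt with e | e
  · subst e
    exact hnext b hb
  · exact (hnext c hc).trans (hw.lt_of_lt e hc hb)

/-- If the state differs from the value of a past transition, another transition has followed. -/
theorem IsWST.exists_next {w : WSTSeq} (hw : IsWST w) {n : ℕ} {a} {t : ℝ} {v : Bool}
    (ha : w.get? n = some a) (hat : a.1 ≤ t) (hv : WSTState w t v) (hne : v ≠ a.2) :
    ∃ b, w.get? (n + 1) = some b ∧ b.1 ≤ t := by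
  by_contra h
  push Not at h
  exact hne (hv.unique (hw.state_of_next ha hat fun b hb => h b hb))

/-- The state right at a transition. -/
theorem IsWST.state_at {w : WSTSeq} (hw : IsWST w) {n : ℕ} {a} {t : ℝ}
    (ha : w.get? n = some a) (hat : a.1 = t) : WSTState w t a.2 :=
  hw.state_of_next ha hat.le fun b hb => hat ▸ hw.increasing n a b ha hb

theorem _root_.WithBot.exists_coe_of_nonneg {x : WithBot ℝ} (h : ((0 : ℝ) : WithBot ℝ) ≤ x) :
    ∃ r : ℝ, x = r ∧ 0 ≤ r := by
  induction x with
  | bot => simp at h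
  | coe r => exact ⟨r, rfl, by simpa using h⟩

/-- A WST signal is determined, up to time `T`, by its state function up to time `T`. -/
theorem IsWST.get?_of_state {w w' : WSTSeq} (hw : IsWST w) (hw' : IsWST w') {T : ℝ}
    (h0 : w.get? 0 = w'.get? 0)
    (hn : ∀ n a, w.get? (n + 1) = some a → ((0 : ℝ) : WithBot ℝ) ≤ a.1)
    (hn' : ∀ n a, w'.get? (n + 1) = some a → ((0 : ℝ) : WithBot ℝ) ≤ a.1)
    (hs : ∀ t : ℝ, 0 ≤ t → t ≤ T → ∃ v, WSTState w t v ∧ WSTState w' t v) (n : ℕ) :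
    ∀ a, w.get? n = some a → a.1 ≤ T → w'.get? n = some a := by
  induction n with
  | zero => intro a ha _; rw [← h0, ha]
  | succ n ih =>
    intro a ha haT
    obtain ⟨b, hb⟩ := w.ge_stable (Nat.le_succ n) ha
    have hba := hw.increasing n b a hb ha
    have hb' := ih b hb (hba.le.trans haT)
    obtain ⟨t, ht, ht0⟩ := WithBot.exists_coe_of_nonneg (hn n a ha)
    have hax := hw.alternating n b a hb ha
    have htT : t ≤ T := by rw [ht] at haT; exact_mod_cast haT
    obtain ⟨v, hv, hv'⟩ := hs t ht0 htT
    have hva : v = !b.2 := hax ▸ hv.unique (hw.state_at ha ht)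
    obtain ⟨a', ha', hat'⟩ := hw'.exists_next hb' (ht ▸ hba.le) hv' (by simp [hva])
    have hax' := hw'.alternating n b a' hb' ha'
    have hba' := hw'.increasing n b a' hb' ha'
    obtain ⟨t', ht', ht0'⟩ := WithBot.exists_coe_of_nonneg (hn' n a' ha')
    have htt : t' ≤ t := by rw [ht'] at hat'; exact_mod_cast hat'
    -- If `w'` switched strictly before `t`, then at `t'` the signal `w` would still have state
    -- `b.2`, whereas `w'` would have state `!b.2`.
    rcases htt.eq_or_lt with e | e
    · rw [ha']
      congr 1
      refine Prod.ext ?_ ?_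
      · rw [ht', ht, e]
      · rw [hax, hax']
    · obtain ⟨v, hv, hv'⟩ := hs t' ht0' (htt.trans htT)
      have h1 := hv'.unique (hw'.state_at ha' ht')
      have h2 := hv.unique (hw.state_of_next hb (ht' ▸ hba'.le) fun c hc => by
        rw [ha] at hc
        cases hc
        rw [ht]
        exact_mod_cast e)
      rw [← h2, h1] at hax'
      simp at hax'

/-! ### TCT signals -/

theorem scheduled_get? (s : TCTSeq) (n : ℕ) :
    (TCTSeq.scheduled s).get? n = (s.get? n).map fun a => (a.t, a.x) :=
  Stream'.Seq.map_get? _ _ _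

theorem scheduled_get?_of {s : TCTSeq} {n : ℕ} {a : Transition} (h : s.get? n = some a) :
    (TCTSeq.scheduled s).get? n = some (a.t, a.x) := by
  rw [scheduled_get?, h]; rfl

theorem exists_of_scheduled_get? {s : TCTSeq} {n : ℕ} {b}
    (h : (TCTSeq.scheduled s).get? n = some b) :
    ∃ a, s.get? n = some a ∧ b = (a.t, a.x) := by
  rw [scheduled_get?] at h
  obtain ⟨a, ha, e⟩ := Option.map_eq_some_iff.1 h
  exact ⟨a, ha, e.symm⟩

theorem IsTCT.lt_of_lt {s : TCTSeq} (hs : IsTCT s) {n m : ℕ} (h : n < m) {a b : Transition}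
    (ha : s.get? n = some a) (hb : s.get? m = some b) : a.t < b.t :=
  hs.wst.lt_of_lt h (scheduled_get?_of ha) (scheduled_get?_of hb)

theorem IsTCT.alternating {s : TCTSeq} (hs : IsTCT s) {n : ℕ} {a b : Transition}
    (ha : s.get? n = some a) (hb : s.get? (n + 1) = some b) : b.x = !a.x :=
  hs.wst.alternating n _ _ (scheduled_get?_of ha) (scheduled_get?_of hb)

theorem IsTCT.exists_count {s : TCTSeq} (hs : IsTCT s) (T : ℝ) :
    ∃ k, 0 < k ∧ ∀ n (a : Transition), s.get? n = some a → (a.t ≤ (T : WithBot ℝ) ↔ n < k) := by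
  obtain ⟨k, hk, h⟩ := hs.wst.exists_count T
  exact ⟨k, hk, fun n a ha => h n _ (scheduled_get?_of ha)⟩

theorem IsTCT.initial {s : TCTSeq} (hs : IsTCT s) : ∃ x, s.get? 0 = some ⟨⊥, x, 0⟩ := by
  obtain ⟨x, hx⟩ := hs.wst.initial
  obtain ⟨a, ha, e⟩ := exists_of_scheduled_get? hx
  have := hs.offset_zero a ha
  obtain ⟨t, y, o⟩ := a
  simp only [Prod.mk.injEq] at e this
  refine ⟨y, ?_⟩
  rw [ha, ← e.1, this]

theorem shifter_get? (c : Bool → ℝ) (s : TCTSeq) (n : ℕ) :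
    (shifter c s).get? n =
      (s.get? n).map fun b => ⟨b.t, b.x, b.o + (c b.x : WithBot ℝ)⟩ :=
  Stream'.Seq.map_get? _ _ _

theorem exists_of_shifter_get? {c : Bool → ℝ} {s : TCTSeq} {n : ℕ} {b : Transition}
    (h : (shifter c s).get? n = some b) :
    ∃ a, s.get? n = some a ∧ b.t = a.t ∧ b.x = a.x ∧ b.occ = a.occ + (c a.x : WithBot ℝ) := by
  rw [shifter_get?] at h
  obtain ⟨a, ha, rfl⟩ := Option.map_eq_some_iff.1 h
  exact ⟨a, ha, rfl, rfl, (add_assoc _ _ _).symm⟩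

theorem shifter_get?_of {c : Bool → ℝ} {s : TCTSeq} {n : ℕ} {a : Transition}
    (h : s.get? n = some a) :
    ∃ b, (shifter c s).get? n = some b ∧ b.t = a.t ∧ b.x = a.x ∧
      b.occ = a.occ + (c a.x : WithBot ℝ) := by
  refine ⟨⟨a.t, a.x, a.o + (c a.x : WithBot ℝ)⟩, by rw [shifter_get?, h]; rfl, rfl, rfl,
    (add_assoc _ _ _).symm⟩

theorem scheduled_shifter (c : Bool → ℝ) (s : TCTSeq) :
    TCTSeq.scheduled (shifter c s) = TCTSeq.scheduled s := by
  apply Stream'.Seq.ext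
  intro n
  rw [scheduled_get?, scheduled_get?, shifter_get?, Option.map_map]
  rfl

/-- The properties of TCT signals that survive a shifter. -/
structure IsOrdered (s : TCTSeq) : Prop where
  wst : IsWST (TCTSeq.scheduled s)
  initial : ∃ a, s.get? 0 = some a ∧ a.t = ⊥ ∧ a.occ = ⊥
  occ_le : ∀ n a b, s.get? n = some a → s.get? (n + 2) = some b → a.occ ≤ b.occ

/-- Occurrence times are compared only at distance two, and alternation gives such transitions the
same direction, so the shifter moves both by the same amount. The zero offset of the initial
transition is lost; only its occurrence at `-∞` survives. -/
theorem IsTCT.isOrdered_shifter {s : TCTSeq} (hs : IsTCT s) (c : Bool → ℝ) :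
    IsOrdered (shifter c s) where
  wst := by rw [scheduled_shifter]; exact hs.wst
  initial := by
    obtain ⟨x, hx⟩ := hs.initial
    obtain ⟨b, hb, h1, -, h2⟩ := shifter_get?_of (c := c) hx
    exact ⟨b, hb, h1, by rw [h2]; simp [Transition.occ]⟩
  occ_le n a b ha hb := by
    obtain ⟨a', ha', -, -, hao⟩ := exists_of_shifter_get? ha
    obtain ⟨b', hb', -, -, hbo⟩ := exists_of_shifter_get? hb
    obtain ⟨m, hm⟩ := s.ge_stable (Nat.le_succ (n + 1)) hb'
    have h1 := hs.alternating ha' hm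
    have h2 := hs.alternating hm hb'
    have hx : b'.x = a'.x := by rw [h2, h1, Bool.not_not]
    rw [hao, hbo, hx]
    exact add_le_add_left (hs.occ_le n a' b' ha' hb') _

namespace IsOrdered

variable {s : TCTSeq}

theorem alternating (hs : IsOrdered s) {n : ℕ} {a b : Transition}
    (ha : s.get? n = some a) (hb : s.get? (n + 1) = some b) : b.x = !a.x :=
  hs.wst.alternating n _ _ (scheduled_get?_of ha) (scheduled_get?_of hb)

theorem exists_count (hs : IsOrdered s) (T : ℝ) :
    ∃ k, 0 < k ∧ ∀ n (a : Transition), s.get? n = some a → (a.t ≤ (T : WithBot ℝ) ↔ n < k) := by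
  obtain ⟨k, hk, h⟩ := hs.wst.exists_count T
  exact ⟨k, hk, fun n a ha => h n _ (scheduled_get?_of ha)⟩

/-- A transition has the value of an earlier one, or it has the opposite value and occurs no earlier
than the successor of that one. -/
theorem eq_or_occ_le (hs : IsOrdered s) {n : ℕ} {a c : Transition} (ha : s.get? n = some a)
    (hc : s.get? (n + 1) = some c) (d : ℕ) :
    ∀ b, s.get? (n + d) = some b → (b.x = a.x ∧ a.occ ≤ b.occ) ∨ (b.x = !a.x ∧ c.occ ≤ b.occ) := by
  induction d using Nat.twoStepInduction with
  | zero =>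
    intro b hb
    rw [Nat.add_zero, ha] at hb
    cases hb
    exact .inl ⟨rfl, le_rfl⟩
  | one =>
    intro b hb
    rw [hc] at hb
    cases hb
    exact .inr ⟨hs.alternating ha hc, le_rfl⟩
  | more d ih _ =>
    intro b hb
    obtain ⟨e, he⟩ := s.ge_stable (show n + d ≤ n + (d + 2) by omega) hb
    obtain ⟨m, hm⟩ := s.ge_stable (show n + d + 1 ≤ n + (d + 2) by omega) hb
    have hx : b.x = e.x := by
      rw [hs.alternating (n := n + d + 1) hm hb, hs.alternating he hm, Bool.not_not]
    have ho := hs.occ_le (n + d) e b he hb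
    rw [hx]
    exact (ih e he).imp (fun h => ⟨h.1, h.2.trans ho⟩) fun h => ⟨h.1, h.2.trans ho⟩

end IsOrdered

/-- Every transition occurs at least `ε` after the time it is scheduled at, unless it cancels a
transition that would not have occurred before. -/
def Causal (ε : ℝ) (s : TCTSeq) : Prop :=
  ∀ n (a b : Transition), s.get? n = some a → s.get? (n + 1) = some b →
    b.t + (ε : WithBot ℝ) ≤ b.occ ∨ (b.occ ≤ a.occ ∧ b.t + (ε : WithBot ℝ) ≤ a.occ)

/-- At time `t`, among the first `k` transitions, the last one that is scheduled and occurs before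
or at `t` has value `v`. -/
def PartState (s : TCTSeq) (k : ℕ) (t : ℝ) (v : Bool) : Prop :=
  ∃ n a, n < k ∧ s.get? n = some a ∧ a.x = v ∧ a.t ≤ t ∧ a.occ ≤ t ∧
    ∀ m, n < m → m < k → ∀ b, s.get? m = some b → b.t ≤ t → ¬ b.occ ≤ t

theorem TCTState.unique {s : TCTSeq} {t : ℝ} {v v' : Bool} (h : TCTState s t v)
    (h' : TCTState s t v') : v = v' := by
  obtain ⟨n, a, hn, hs, hc, hv, hmax⟩ := h
  obtain ⟨n', a', hn', hs', hc', hv', hmax'⟩ := h'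
  rcases lt_trichotomy n n' with h | h | h
  · rw [← hv', hmax _ h _ hn' hs' hc']
  · subst h
    rw [hn] at hn'
    cases hn'
    rw [← hv, hv']
  · rw [← hv, hmax' _ h _ hn hs hc]

theorem IsOrdered.exists_partState {s : TCTSeq} (hs : IsOrdered s) {k : ℕ} (hk : 0 < k) (t : ℝ) :
    ∃ v, PartState s k t v := by
  induction k, hk using Nat.le_induction with
  | base =>
    obtain ⟨a, ha, h1, h2⟩ := hs.initial
    exact ⟨a.x, 0, a, by omega, ha, rfl, by simp [h1], by simp [h2], fun m _ _ => by omega⟩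
  | succ k hk ih =>
    by_cases h : ∃ a, s.get? k = some a ∧ a.t ≤ t ∧ a.occ ≤ t
    · obtain ⟨a, ha, h1, h2⟩ := h
      exact ⟨a.x, k, a, by omega, ha, rfl, h1, h2, fun m _ _ => by omega⟩
    · push Not at h
      obtain ⟨v, n, a, hnk, ha, hv, h1, h2, hmax⟩ := ih
      refine ⟨v, n, a, by omega, ha, hv, h1, h2, fun m hm hmk b hb hbt => ?_⟩
      rcases (Nat.lt_succ_iff.1 hmk).eq_or_lt with e | e
      · subst e
        exact not_le.2 (h b hb hbt)
      · exact hmax m hm e b hb hbt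

/-- In a causal signal, transitions scheduled later than `t - ε` do not affect the state at `t`. -/
theorem PartState.tctState {s : TCTSeq} (hs : IsOrdered s) {ε : ℝ} (hε : 0 ≤ ε) (hc : Causal ε s)
    {k : ℕ} {t : ℝ} {v : Bool}
    (hk : ∀ m ≥ k, ∀ b, s.get? m = some b → (t : WithBot ℝ) < b.t + (ε : WithBot ℝ))
    (h : PartState s k t v) : TCTState s t v := by
  obtain ⟨n, a, hnk, ha, hv, hat, hao, hmax⟩ := h
  have hle : ∀ x : WithBot ℝ, x ≤ x + (ε : WithBot ℝ) := fun x =>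
    le_add_of_nonneg_right (by exact_mod_cast hε)
  -- The successor of `n` is scheduled later than `t - ε`, by maximality of `n` or by `hk`. If it
  -- occurred by `t`, either alternative of causality would put an occurrence time both at or before
  -- `t` and after `t`.
  have hlate : ∀ b, s.get? (n + 1) = some b → (t : WithBot ℝ) < b.occ := by
    intro b hb
    by_contra hbo
    rw [not_lt] at hbo
    have hlt : (t : WithBot ℝ) < b.t + (ε : WithBot ℝ) := by
      by_cases hm : n + 1 < k
      · by_contra hbt
        rw [not_lt] at hbt
        exact hmax _ (Nat.lt_succ_self n) hm b hb ((hle _).trans hbt) hbo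
      · exact hk _ (not_lt.1 hm) b hb
    rcases hc n a b ha hb with h | h
    · exact absurd (hlt.trans_le (h.trans hbo)) (lt_irrefl _)
    · exact absurd (hlt.trans_le (h.2.trans hao)) (lt_irrefl _)
  refine ⟨n, a, ha, hao, ?_, hv, fun m hm b hb hbt _ => ?_⟩
  · rintro ⟨a', b, ha', hb, hba⟩
    rw [ha] at ha'
    cases ha'
    exact absurd ((hlate b hb).trans_le (hba.trans hao)) (lt_irrefl _)
  · obtain ⟨c, hcc⟩ := s.ge_stable (show n + 1 ≤ m from hm) hb
    -- A later transition in the opposite direction occurs no earlier than the successor of `n`,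
    -- hence after `t`.
    rcases hs.eq_or_occ_le ha hcc (m - n) b (by rwa [Nat.add_sub_cancel' hm.le]) with h | h
    · rw [h.1, hv]
    · exact absurd ((hlate c hcc).trans_le (h.2.trans hbt)) (lt_irrefl _)

theorem IsOrdered.exists_tctState {s : TCTSeq} (hs : IsOrdered s) {ε : ℝ} (hε : 0 ≤ ε)
    (hc : Causal ε s) (t : ℝ) : ∃ v, TCTState s t v := by
  obtain ⟨k, hk0, hk⟩ := hs.exists_count t
  obtain ⟨v, hv⟩ := hs.exists_partState hk0 t
  refine ⟨v, hv.tctState hs hε hc fun m hm b hb => ?_⟩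
  have : ¬ b.t ≤ t := fun h => absurd ((hk m b hb).1 h) (not_lt.2 hm)
  exact (not_le.1 this).trans_le (le_add_of_nonneg_right (by exact_mod_cast hε))

/-- The sequences have the same transitions scheduled up to time `T`. -/
def AgreeUpTo (T : ℝ) (s s' : TCTSeq) : Prop :=
  ∀ n (a : Transition), a.t ≤ T → (s.get? n = some a ↔ s'.get? n = some a)

theorem AgreeUpTo.symm {T : ℝ} {s s' : TCTSeq} (h : AgreeUpTo T s s') : AgreeUpTo T s' s :=
  fun n a ha => (h n a ha).symm

theorem AgreeUpTo.trans {T : ℝ} {s s' s'' : TCTSeq} (h : AgreeUpTo T s s')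
    (h' : AgreeUpTo T s' s'') : AgreeUpTo T s s'' :=
  fun n a ha => (h n a ha).trans (h' n a ha)

theorem AgreeUpTo.mono {T T' : ℝ} {s s' : TCTSeq} (h : AgreeUpTo T s s') (hT : T' ≤ T) :
    AgreeUpTo T' s s' :=
  fun n a ha => h n a (ha.trans (by exact_mod_cast hT))

theorem _root_.WithBot.exists_le_coe (x : WithBot ℝ) : ∃ r : ℝ, x ≤ r := by
  induction x with
  | bot => exact ⟨0, bot_le⟩
  | coe r => exact ⟨r, le_rfl⟩

theorem AgreeUpTo.eq_of_forall {s s' : TCTSeq} (h : ∀ T : ℝ, AgreeUpTo T s s') : s = s' := by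
  apply Stream'.Seq.ext
  intro n
  apply Option.ext
  intro a
  obtain ⟨r, hr⟩ := WithBot.exists_le_coe a.t
  exact h r n a hr

theorem AgreeUpTo.shifter {T : ℝ} {s s' : TCTSeq} (h : AgreeUpTo T s s') (c : Bool → ℝ) :
    AgreeUpTo T (shifter c s) (shifter c s') := by
  have key : ∀ s s' : TCTSeq, AgreeUpTo T s s' → ∀ n (a : Transition), a.t ≤ T →
      (CIDM.shifter c s).get? n = some a → (CIDM.shifter c s').get? n = some a := by
    intro s s' h n a ha hsa
    rw [shifter_get?] at hsa ⊢
    obtain ⟨b, hb, rfl⟩ := Option.map_eq_some_iff.1 hsa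
    rw [(h n b ha).1 hb]
    rfl
  exact fun n a ha => ⟨key _ _ h n a ha, key _ _ h.symm n a ha⟩

/-- Causal signals that agree up to time `T` have the same state up to time `T + ε`. -/
theorem AgreeUpTo.exists_tctState {T ε t : ℝ} {s s' : TCTSeq} (h : AgreeUpTo T s s')
    (hs : IsOrdered s) (hs' : IsOrdered s') (hε : 0 ≤ ε) (hc : Causal ε s) (hc' : Causal ε s')
    (ht : t ≤ T + ε) : ∃ v, TCTState s t v ∧ TCTState s' t v := by
  obtain ⟨k, hk0, hk⟩ := hs.exists_count T
  obtain ⟨k', -, hk'⟩ := hs'.exists_count T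
  -- What the two signals do not share is scheduled after `T ≥ t - ε`, too late to affect the state
  -- at `t`.
  have late : ∀ (s : TCTSeq) (k : ℕ),
      (∀ n a, s.get? n = some a → (a.t ≤ (T : WithBot ℝ) ↔ n < k)) →
      ∀ m ≥ k, ∀ b, s.get? m = some b → (t : WithBot ℝ) < b.t + (ε : WithBot ℝ) := by
    intro s k hk m hm b hb
    have hlt : (T : WithBot ℝ) < b.t :=
      not_le.1 fun h => absurd ((hk m b hb).1 h) (not_lt.2 hm)
    generalize b.t = x at hlt
    induction x with
    | bot => simp at hlt
    | coe r =>
      have : T < r := by exact_mod_cast hlt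
      have : t < r + ε := by linarith
      exact_mod_cast this
  obtain ⟨v, hv⟩ := hs.exists_partState hk0 t
  refine ⟨v, hv.tctState hs hε hc (late s k hk), PartState.tctState hs' hε hc' (late s' k' hk') ?_⟩
  -- The counts `k` and `k'` are not determined beyond the end of a finite signal, so indices are
  -- compared through `a.t ≤ T` rather than through `k = k'`.
  obtain ⟨n, a, hnk, ha, hv, hat, hao, hmax⟩ := hv
  have haT := (hk n a ha).2 hnk
  have ha' := (h n a haT).1 ha
  refine ⟨n, a, (hk' n a ha').1 haT, ha', hv, hat, hao, fun m hm hmk b hb => ?_⟩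
  have hbT := (hk' m b hb).2 hmk
  have hb' := (h m b hbT).2 hb
  exact hmax m hm ((hk m b hb').1 hbT) b hb'

/-! ### Step functions -/

/-- `g` is a right-continuous step function that changes only at times in the locally finite
set `Q`. -/
structure StepOn (Q : Set ℝ) (g : ℝ → Bool) : Prop where
  finite : ∀ T, (Q ∩ Iic T).Finite
  const : ∀ s t, s ≤ t → (∀ q ∈ Q, s < q → ¬ q ≤ t) → g s = g t

open Classical in
/-- The next transition of a signal with state function `g` after the transition `a`. -/
def nextChange (g : ℝ → Bool) (a : WithBot ℝ × Bool) : Option (WithBot ℝ × Bool) :=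
  if h : ∃ t, IsLeast {t : ℝ | a.1 < t ∧ g t ≠ a.2} t then some ((h.choose : ℝ), !a.2) else none

/-- The sequence of transitions of a step function with initial value `x₀`. -/
def changes (g : ℝ → Bool) (x₀ : Bool) : WSTSeq :=
  ⟨fun n => Nat.rec (some (⊥, x₀)) (fun _ o => o.bind (nextChange g)) n, by
    intro n h
    exact congrArg (fun o => Option.bind o (nextChange g)) h⟩

theorem changes_zero (g : ℝ → Bool) (x₀ : Bool) : (changes g x₀).get? 0 = some (⊥, x₀) := rfl

theorem changes_succ (g : ℝ → Bool) (x₀ : Bool) (n : ℕ) :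
    (changes g x₀).get? (n + 1) = ((changes g x₀).get? n).bind (nextChange g) := rfl

theorem nextChange_eq_some {g : ℝ → Bool} {a b : WithBot ℝ × Bool} (h : nextChange g a = some b) :
    b.2 = (!a.2) ∧ ∃ t : ℝ, b.1 = t ∧ IsLeast {t : ℝ | a.1 < t ∧ g t ≠ a.2} t := by
  unfold nextChange at h
  split_ifs at h with hex
  cases h
  exact ⟨rfl, _, rfl, hex.choose_spec⟩

theorem nextChange_of_isLeast {g : ℝ → Bool} {a : WithBot ℝ × Bool} {t : ℝ}
    (h : IsLeast {t : ℝ | a.1 < t ∧ g t ≠ a.2} t) :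
    nextChange g a = some ((t : WithBot ℝ), !a.2) := by
  unfold nextChange
  have hex : ∃ t, IsLeast {t : ℝ | a.1 < t ∧ g t ≠ a.2} t := ⟨t, h⟩
  rw [dif_pos hex, hex.choose_spec.unique h]

namespace StepOn

variable {Q : Set ℝ} {g : ℝ → Bool} {x₀ : Bool}

/-- `a` is the initial transition or a transition to the current value of `g`. -/
def Start (g : ℝ → Bool) (x₀ : Bool) (a : WithBot ℝ × Bool) : Prop :=
  a = (⊥, x₀) ∨ ∃ t : ℝ, a.1 = t ∧ g t = a.2

/-- From the largest point of `Q` up to `t` onwards, `g` keeps the value `g t`. If this point did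
not lie after `a`, or if there were none, `g` would not have changed between `a` and `t`. -/
theorem exists_change_le (h : StepOn Q g) (h0 : ∀ t < 0, g t = x₀) {a : WithBot ℝ × Bool}
    (ha : Start g x₀ a) {t : ℝ} (ht : a.1 < t) (hg : g t ≠ a.2) :
    ∃ q ∈ Q, a.1 < q ∧ g q ≠ a.2 ∧ q ≤ t := by
  by_cases hne : (Q ∩ Iic t).Nonempty
  · obtain ⟨q, ⟨hqQ, hqt⟩, hmax⟩ := (h.finite t).exists_maximalFor id _ hne
    have hmax' : ∀ q' ∈ Q, q < q' → ¬ q' ≤ t := fun q' hq' hlt hle =>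
      absurd (hmax ⟨hq', hle⟩ hlt.le) (not_le.2 hlt)
    have hgq : g q = g t := h.const q t hqt hmax'
    refine ⟨q, hqQ, ?_, hgq ▸ hg, hqt⟩
    by_contra hqa
    rcases ha with rfl | ⟨r, hr, hgr⟩
    · simp at hqa
    · rw [hr] at hqa ht
      have hqr : q ≤ r := by exact_mod_cast not_lt.1 hqa
      have hrt : r < t := by exact_mod_cast ht
      exact hg (by rw [← hgr]; exact (h.const r t hrt.le fun q' hq' hlt =>
        hmax' q' hq' (hqr.trans_lt hlt)).symm)
  · exfalso
    rw [not_nonempty_iff_eq_empty] at hne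
    have hno : ∀ q ∈ Q, ¬ q ≤ t := fun q hq hle => by
      have : q ∈ Q ∩ Iic t := ⟨hq, hle⟩
      rw [hne] at this
      exact this
    rcases ha with rfl | ⟨r, hr, hgr⟩
    · refine hg ?_
      -- `min t (-1)` is a time before both `0` and `t`, so `g` still has its initial value there.
      rw [← h0 (min t (-1)) (by simp), h.const (min t (-1)) t (min_le_left _ _)
        fun q hq _ => hno q hq]
    · rw [hr] at ht
      have hrt : r < t := by exact_mod_cast ht
      exact hg (by rw [← hgr]; exact (h.const r t hrt.le fun q hq _ => hno q hq).symm)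

/-- Below every time of this set lies one that belongs to `Q` as well, and only finitely many of
those are at most `t`. The least of them is the least element. -/
theorem exists_isLeast (h : StepOn Q g) (h0 : ∀ t < 0, g t = x₀) {a : WithBot ℝ × Bool}
    (ha : Start g x₀ a) {t : ℝ} (ht : a.1 < t) (hg : g t ≠ a.2) :
    ∃ q, IsLeast {t : ℝ | a.1 < t ∧ g t ≠ a.2} q := by
  obtain ⟨q₀, hq₀, h1, h2, h3⟩ := h.exists_change_le h0 ha ht hg
  have hfin : ((Q ∩ Iic t) ∩ {t : ℝ | a.1 < t ∧ g t ≠ a.2}).Finite := (h.finite t).inter_of_left _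
  obtain ⟨q, ⟨⟨hqQ, hqt⟩, hqa⟩, hmin⟩ := hfin.exists_minimalFor id _ ⟨q₀, ⟨hq₀, h3⟩, h1, h2⟩
  refine ⟨q, hqa, fun s hs => ?_⟩
  obtain ⟨q', hq', h1', h2', h3'⟩ := h.exists_change_le h0 ha hs.1 hs.2
  refine le_trans ?_ h3'
  by_contra hlt
  rw [not_le] at hlt
  exact absurd (hmin ⟨⟨hq', hlt.le.trans hqt⟩, h1', h2'⟩ hlt.le) (not_le.2 hlt)

theorem start_changes (n : ℕ) :
    ∀ a, (changes g x₀).get? n = some a → Start g x₀ a := by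
  cases n with
  | zero =>
    intro a ha
    rw [changes_zero] at ha
    cases ha
    exact .inl rfl
  | succ n =>
    intro a ha
    rw [changes_succ] at ha
    obtain ⟨b, hb, hba⟩ := Option.bind_eq_some_iff.1 ha
    obtain ⟨h1, t, h2, h3⟩ := nextChange_eq_some hba
    exact .inr ⟨t, h2, by rw [h1]; exact Bool.eq_not.2 h3.1.2⟩

theorem changes_succ_mem (h : StepOn Q g) (h0 : ∀ t < 0, g t = x₀) {n : ℕ} {b}
    (hb : (changes g x₀).get? (n + 1) = some b) : ∃ q ∈ Q, b.1 = (q : ℝ) := by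
  rw [changes_succ] at hb
  obtain ⟨a, ha, hab⟩ := Option.bind_eq_some_iff.1 hb
  obtain ⟨h1, t, h2, h3⟩ := nextChange_eq_some hab
  obtain ⟨q, hq, h4, h5, h6⟩ := h.exists_change_le h0 (start_changes n a ha) h3.1.1 h3.1.2
  exact ⟨q, hq, by rw [h2, le_antisymm (h3.2 ⟨h4, h5⟩) h6]⟩

theorem isWST_changes (h : StepOn Q g) (h0 : ∀ t < 0, g t = x₀) : IsWST (changes g x₀) := by
  have hstep : ∀ n a b, (changes g x₀).get? n = some a → (changes g x₀).get? (n + 1) = some b →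
      b.2 = (!a.2) ∧ a.1 < b.1 := by
    intro n a b ha hb
    rw [changes_succ, ha] at hb
    obtain ⟨h1, t, h2, h3⟩ := nextChange_eq_some hb
    exact ⟨h1, by rw [h2]; exact h3.1.1⟩
  refine ⟨⟨x₀, rfl⟩, fun n a b ha hb => (hstep n a b ha hb).1,
    fun n a b ha hb => (hstep n a b ha hb).2, fun hinf L => ?_⟩
  by_contra hbd
  push Not at hbd
  -- A bounded infinite sequence of changes would give infinitely many distinct points of `Q` up to
  -- `L`.
  have hex : ∀ n, ∃ q : ℝ, ∃ a, (changes g x₀).get? (n + 1) = some a ∧ a.1 = q ∧ q ∈ Q ∩ Iic L := by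
    intro n
    obtain ⟨a, ha⟩ := Option.ne_none_iff_exists'.1 (hinf (n + 1))
    obtain ⟨q, hq, hqa⟩ := h.changes_succ_mem h0 ha
    have := hbd _ a ha
    rw [hqa] at this
    exact ⟨q, a, ha, hqa, hq, by exact_mod_cast this⟩
  choose q a ha hqa hq using hex
  have hmono : StrictMono q := by
    refine strictMono_nat_of_lt_succ fun n => ?_
    have := (hstep _ _ _ (ha n) (ha (n + 1))).2
    rw [hqa, hqa] at this
    exact_mod_cast this
  exact (h.finite L).not_infinite (infinite_of_injective_forall_mem hmono.injective hq)

/-- If `g t` differed from the value of the last transition up to `t`, there would be a further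
change at a time not exceeding `t`. -/
theorem wstState_changes (h : StepOn Q g) (h0 : ∀ t < 0, g t = x₀) (t : ℝ) :
    WSTState (changes g x₀) t (g t) := by
  have hw := h.isWST_changes h0
  obtain ⟨k, hk0, hk⟩ := hw.exists_count t
  have hex : ∃ n a, (changes g x₀).get? n = some a ∧ a.1 ≤ t ∧
      ∀ b, (changes g x₀).get? (n + 1) = some b → (t : WithBot ℝ) < b.1 := by
    by_contra hno
    push Not at hno
    have : ∀ n, ∃ a, (changes g x₀).get? n = some a ∧ a.1 ≤ t := by
      intro n
      induction n with
      | zero => exact ⟨_, changes_zero g x₀, bot_le⟩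
      | succ n ih =>
        obtain ⟨a, ha, hat⟩ := ih
        exact hno n a ha hat
    obtain ⟨a, ha, hat⟩ := this k
    exact absurd ((hk k a ha).1 hat) (lt_irrefl _)
  obtain ⟨n, a, ha, hat, hnext⟩ := hex
  have hst := hw.state_of_next ha hat hnext
  by_cases hg : g t = a.2
  · rwa [hg]
  exfalso
  have hS := start_changes n a ha
  have hlt : a.1 < t := by
    refine hat.lt_of_ne fun e => ?_
    rcases hS with rfl | ⟨r, hr, hgr⟩
    · simp at e
    · rw [hr] at e
      have : r = t := by exact_mod_cast e
      exact hg (this ▸ hgr)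
  obtain ⟨q, hq⟩ := h.exists_isLeast h0 hS hlt hg
  have hb := hnext ((q : WithBot ℝ), !a.2) (by rw [changes_succ, ha]; exact nextChange_of_isLeast hq)
  have hqt : q ≤ t := hq.2 ⟨hlt, hg⟩
  exact absurd (WithBot.coe_lt_coe.1 hb) (not_lt.2 hqt)

end StepOn

/-! ### The gate output -/

/-- The state function of a causal signal is a step function. -/
theorem IsOrdered.exists_stepOn {s : TCTSeq} (hs : IsOrdered s) {ε : ℝ} (hε : 0 ≤ ε)
    (hc : Causal ε s) : ∃ (Q : Set ℝ) (g : ℝ → Bool), StepOn Q g ∧ ∀ t, TCTState s t (g t) := by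
  choose g hg using hs.exists_tctState hε hc
  -- A transition starts to count for `PartState` at the time `max a.t a.occ`, so the state can
  -- change only at these times.
  refine ⟨{q : ℝ | ∃ n a, s.get? n = some a ∧ max a.t a.occ = q}, g, ⟨fun T => ?_, ?_⟩, hg⟩
  · obtain ⟨k, -, hk⟩ := hs.exists_count T
    refine ((finite_Iio k).image fun n =>
      ((s.get? n).map fun a => (max a.t a.occ).unbotD 0).getD 0).subset ?_
    rintro q ⟨⟨n, a, ha, hq⟩, hqT⟩
    refine ⟨n, (hk n a ha).1 ?_, ?_⟩
    · refine (le_max_left a.t a.occ).trans ?_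
      rw [hq]
      exact_mod_cast hqT
    · simp [ha, hq]
  · intro r t hrt hno
    -- The count is taken at the later time `t`, so that one prefix describes the states at both `r`
    -- and `t`.
    obtain ⟨k, hk0, hk⟩ := hs.exists_count t
    obtain ⟨v, hv⟩ := hs.exists_partState hk0 r
    have hlate : ∀ m ≥ k, ∀ b, s.get? m = some b → (t : WithBot ℝ) < b.t + (ε : WithBot ℝ) := by
      intro m hm b hb
      have : ¬ b.t ≤ t := fun h => absurd ((hk m b hb).1 h) (not_lt.2 hm)
      exact (not_le.1 this).trans_le (le_add_of_nonneg_right (by exact_mod_cast hε))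
    have hrt' : (r : WithBot ℝ) ≤ t := by exact_mod_cast hrt
    have h1 := hv.tctState hs hε hc fun m hm b hb => hrt'.trans_lt (hlate m hm b hb)
    have hv' : PartState s k t v := by
      obtain ⟨n, a, hnk, ha, hv, hat, hao, hmax⟩ := hv
      refine ⟨n, a, hnk, ha, hv, hat.trans hrt', hao.trans hrt', fun m hm hmk b hb hbt hbo => ?_⟩
      have hbr : ¬ max b.t b.occ ≤ (r : WithBot ℝ) := fun h =>
        hmax m hm hmk b hb ((le_max_left _ _).trans h) ((le_max_right _ _).trans h)
      have hbt' : max b.t b.occ ≤ (t : WithBot ℝ) := max_le hbt hbo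
      generalize hz : max b.t b.occ = z at hbr hbt'
      induction z with
      | bot => simp at hbr
      | coe q =>
        exact hno q ⟨m, b, hb, hz⟩ (by exact_mod_cast not_le.1 hbr) (by exact_mod_cast hbt')
    rw [(hg r).unique h1, (hg t).unique (hv'.tctState hs hε hc hlate)]

/-- The gate value is a step function of time: there are finitely many inputs, each changing at a
locally finite set of times. Its sequence of changes is the output. -/
theorem Channel.exists_isGateOutput (C : Channel) (x₀ : Bool) (up : Fin C.d → TCTSeq)
    (hup : ∀ I, IsOrdered (up I)) (hc : ∀ I, ∃ ε, 0 ≤ ε ∧ Causal ε (up I)) :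
    ∃ ug, C.IsGateOutput x₀ up ug := by
  have hex : ∀ I, ∃ (Q : Set ℝ) (g : ℝ → Bool), StepOn Q g ∧ ∀ t, TCTState (up I) t (g t) := by
    intro I
    obtain ⟨ε, hε, h⟩ := hc I
    exact (hup I).exists_stepOn hε h
  choose Q g hQ hg using hex
  set G : ℝ → Bool := fun t => if t < 0 then x₀ else C.f fun I => g I t with hG
  have h0 : ∀ t < 0, G t = x₀ := fun t ht => by simp [hG, ht]
  -- Time `0` is a possible change of its own, because the reset is released there.
  have hstep : StepOn (insert 0 ((⋃ I, Q I) ∩ Ici 0)) G := by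
    refine ⟨fun T => ?_, fun s t hst hno => ?_⟩
    · refine ((finite_singleton (0 : ℝ)).union
        (finite_iUnion fun I => (hQ I).finite T)).subset ?_
      rintro q ⟨rfl | ⟨hq, -⟩, hqT⟩
      · exact .inl rfl
      · obtain ⟨I, hI⟩ := mem_iUnion.1 hq
        exact .inr (mem_iUnion.2 ⟨I, hI, hqT⟩)
    · rcases lt_or_ge t 0 with ht | ht
      · rw [h0 t ht, h0 s (hst.trans_lt ht)]
      · have hs : 0 ≤ s := by
          by_contra hs
          exact hno 0 (mem_insert _ _) (not_le.1 hs) ht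
        simp only [hG, not_lt.2 ht, not_lt.2 hs, if_false]
        congr 1
        ext I
        exact (hQ I).const s t hst fun q hq hsq =>
          hno q (.inr ⟨mem_iUnion.2 ⟨I, hq⟩, hs.trans hsq.le⟩) hsq
  refine ⟨changes G x₀, hstep.isWST_changes h0, changes_zero _ _, fun n a ha => ?_, fun t ht => ?_⟩
  · obtain ⟨q, hq, hqa⟩ := hstep.changes_succ_mem h0 ha
    rw [hqa]
    rcases hq with rfl | ⟨-, hq⟩
    · exact le_rfl
    · exact_mod_cast hq
  · have := hstep.wstState_changes h0 t
    simp only [hG, not_lt.2 ht, if_false] at this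
    exact ⟨fun I => g I t, fun I => hg I t, this⟩

/-! ### The involution channel -/

/-- The output transition for the gate transition `b` if the preceding output transition is `a`. -/
def delayNext (C : Channel) (a : Transition) (b : WithBot ℝ × Bool) : Transition :=
  ⟨b.1, b.2, match b.1 with
    | ⊥ => 0
    | (t : ℝ) => (C.inv.delay b.2 (elapsed t a.occ) : ℝ)⟩

/-- The transitions of the output of the involution channel. -/
def delayAux (C : Channel) (ug : WSTSeq) : ℕ → Option Transition
  | 0 => (ug.get? 0).map fun b => ⟨b.1, b.2, 0⟩
  | n + 1 => (delayAux C ug n).bind fun a => (ug.get? (n + 1)).map (delayNext C a)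

theorem delayAux_map (C : Channel) (ug : WSTSeq) (n : ℕ) :
    (delayAux C ug n).map (fun a => (a.t, a.x)) = ug.get? n := by
  induction n with
  | zero => simp [delayAux, Function.comp_def]
  | succ n ih =>
    simp only [delayAux]
    cases h : ug.get? (n + 1) with
    | none => simp
    | some b =>
      obtain ⟨c, hc⟩ := ug.ge_stable (Nat.le_succ n) h
      rw [hc] at ih
      obtain ⟨a, ha, -⟩ := Option.map_eq_some_iff.1 ih
      simp [ha, delayNext]

theorem Channel.exists_isDelayOutput (C : Channel) (ug : WSTSeq) :
    ∃ s, C.IsDelayOutput ug s := by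
  have hseq : Stream'.IsSeq (delayAux C ug) := by
    intro n h
    change delayAux C ug n = none at h
    simp [delayAux, h]
  obtain ⟨s, hs⟩ : ∃ s : TCTSeq, ∀ n, s.get? n = delayAux C ug n :=
    ⟨⟨delayAux C ug, hseq⟩, fun _ => rfl⟩
  refine ⟨s, ?_, ?_, ?_⟩
  · apply Stream'.Seq.ext
    intro n
    rw [scheduled_get?, hs]
    exact delayAux_map C ug n
  · intro a ha
    rw [hs, delayAux] at ha
    obtain ⟨b, hb, rfl⟩ := Option.map_eq_some_iff.1 ha
    rfl
  · intro n a b t ha hb ht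
    rw [hs] at ha hb
    simp only [delayAux, ha, Option.bind_some] at hb
    obtain ⟨⟨t', x⟩, hc, rfl⟩ := Option.map_eq_some_iff.1 hb
    simp only [delayNext] at ht ⊢
    subst ht
    rfl

/-- The outputs of the involution channel agree as long as its inputs do. -/
theorem Channel.IsDelayOutput.get?_eq {C : Channel} {ug ug' : WSTSeq} {s s' : TCTSeq}
    (h : C.IsDelayOutput ug s) (h' : C.IsDelayOutput ug' s') (hw : IsWST ug) {T : ℝ}
    (hg : ∀ n a, ug.get? n = some a → a.1 ≤ T → ug'.get? n = some a) (n : ℕ) :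
    ∀ a, s.get? n = some a → a.t ≤ T → s'.get? n = some a := by
  have key : ∀ n (a : Transition), s.get? n = some a → a.t ≤ T →
      ∃ b, s'.get? n = some b ∧ b.t = a.t ∧ b.x = a.x := by
    intro n a ha haT
    have h1 := scheduled_get?_of ha
    rw [h.scheduled] at h1
    have h2 := hg n _ h1 haT
    rw [← h'.scheduled] at h2
    obtain ⟨b, hb, e⟩ := exists_of_scheduled_get? h2
    simp only [Prod.mk.injEq] at e
    exact ⟨b, hb, e.1.symm, e.2.symm⟩
  induction n with
  | zero =>
    intro a ha haT
    obtain ⟨b, hb, h1, h2⟩ := key 0 a ha haT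
    have h3 := h.offset_zero a ha
    have h4 := h'.offset_zero b hb
    rw [hb]
    cases a; cases b
    simp_all
  | succ n ih =>
    intro a ha haT
    obtain ⟨b, hb, h1, h2⟩ := key _ a ha haT
    obtain ⟨c, hc⟩ := s.ge_stable (Nat.le_succ n) ha
    have hca : c.t < a.t := by
      have e1 := scheduled_get?_of hc
      have e2 := scheduled_get?_of ha
      rw [h.scheduled] at e1 e2
      exact hw.increasing n _ _ e1 e2
    have hc' := ih c hc (hca.le.trans haT)
    obtain ⟨t, ht⟩ := WithBot.ne_bot_iff_exists.1 (bot_le.trans_lt hca).ne'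
    have h3 := h.offset n c a t hc ha ht.symm
    have h4 := h'.offset n c b t hc' hb (h1.trans ht.symm)
    rw [hb]
    cases a; cases b
    simp_all

/-! ### Delay functions near zero and at infinity. -/

namespace Involution

variable (c : Involution)

theorem δ_le_lim {x : Bool} {T : ℝ} (hT : -c.lim (!x) < T) : c.δ x T ≤ c.lim x := by
  refine ge_of_tendsto (c.tendsto_lim x) ?_
  filter_upwards [eventually_ge_atTop T] with S hS
  exact (c.strictMono x).monotoneOn hT (hT.trans_le hS) hS

theorem δ_lt_lim {x : Bool} {T : ℝ} (hT : -c.lim (!x) < T) : c.δ x T < c.lim x := by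
  have h1 : -c.lim (!x) < T + 1 := by linarith
  exact ((c.strictMono x) hT h1 (by linarith)).trans_le (c.δ_le_lim h1)

/-- A concave function is continuous on an open interval, so `δ(0) > 0` persists as `δ(-ε) - ε > 0`
for small `ε`. -/
theorem eventually_margin (h : c.StrictlyCausal) :
    ∀ᶠ ε in 𝓝[>] (0 : ℝ), ∀ x, -c.lim (!x) < -ε ∧ ε ≤ c.δ x (-ε) := by
  have hx : ∀ x, ∀ᶠ ε in 𝓝 (0 : ℝ), -c.lim (!x) < -ε ∧ ε ≤ c.δ x (-ε) := by
    intro x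
    obtain ⟨h0, hpos⟩ := h x
    have hcont : ContinuousAt (c.δ x) 0 :=
      ((c.concave x).continuousOn isOpen_Ioi).continuousAt (isOpen_Ioi.mem_nhds h0)
    have hneg : Tendsto (fun ε : ℝ => -ε) (𝓝 0) (𝓝 0) := by
      simpa using (continuous_neg (G := ℝ)).tendsto 0
    have h1 : ∀ᶠ ε in 𝓝 (0 : ℝ), -c.lim (!x) < -ε :=
      hneg.eventually (isOpen_Ioi.mem_nhds h0)
    have h2 : Tendsto (fun ε : ℝ => c.δ x (-ε) - ε) (𝓝 0) (𝓝 (c.δ x 0 - 0)) :=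
      (hcont.tendsto.comp hneg).sub tendsto_id
    have h3 : ∀ᶠ ε in 𝓝 (0 : ℝ), 0 < c.δ x (-ε) - ε :=
      h2.eventually (isOpen_Ioi.mem_nhds (by simpa using hpos))
    filter_upwards [h1, h3] with ε h1 h3
    exact ⟨h1, by linarith⟩
  exact (eventually_all.2 hx).filter_mono nhdsWithin_le_nhds

end Involution

/-! ### Order and causality of the output of an involution channel. -/

namespace Channel.IsDelayOutput

variable {C : Channel} {ug : WSTSeq} {s : TCTSeq}

theorem isWST (h : C.IsDelayOutput ug s) (hw : IsWST ug) : IsWST (TCTSeq.scheduled s) := by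
  rw [h.scheduled]; exact hw

theorem initial (h : C.IsDelayOutput ug s) (hw : IsWST ug) : ∃ x, s.get? 0 = some ⟨⊥, x, 0⟩ := by
  obtain ⟨x, hx⟩ := (h.isWST hw).initial
  obtain ⟨a, ha, e⟩ := exists_of_scheduled_get? hx
  have := h.offset_zero a ha
  obtain ⟨t, y, o⟩ := a
  simp only [Prod.mk.injEq] at e this
  exact ⟨y, by rw [ha, ← e.1, this]⟩

theorem offset_one (h : C.IsDelayOutput ug s) (hw : IsWST ug) {b : Transition}
    (hb : s.get? 1 = some b) : ∃ t : ℝ, b.t = t ∧ b.o = (C.inv.lim b.x : ℝ) := by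
  obtain ⟨x, hx⟩ := h.initial hw
  have hlt := (h.isWST hw).increasing 0 _ _ (scheduled_get?_of hx) (scheduled_get?_of hb)
  obtain ⟨t, ht⟩ := WithBot.ne_bot_iff_exists.1 (bot_le.trans_lt hlt).ne'
  refine ⟨t, ht.symm, ?_⟩
  rw [h.offset 0 _ b t hx hb ht.symm]
  simp [Transition.occ, elapsed, Involution.delay]

/-- The delays are always evaluated inside the domains of the delay functions. -/
theorem offset_le (h : C.IsDelayOutput ug s) (hw : IsWST ug) (n : ℕ) :
    ∀ b, s.get? (n + 1) = some b → ∃ t o : ℝ, b.t = t ∧ b.o = o ∧ o ≤ C.inv.lim b.x := by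
  induction n with
  | zero =>
    intro b hb
    obtain ⟨t, ht, ho⟩ := h.offset_one hw hb
    exact ⟨t, _, ht, ho, le_rfl⟩
  | succ n ih =>
    intro b hb
    obtain ⟨a, ha⟩ := s.ge_stable (Nat.le_succ (n + 1)) hb
    obtain ⟨t, o, hat, hao, hle⟩ := ih a ha
    have hlt := (h.isWST hw).increasing (n + 1) _ _ (scheduled_get?_of ha) (scheduled_get?_of hb)
    have hx := (h.isWST hw).alternating (n + 1) _ _ (scheduled_get?_of ha) (scheduled_get?_of hb)
    simp only at hlt hx
    obtain ⟨t', ht'⟩ := WithBot.ne_bot_iff_exists.1 (bot_le.trans_lt hlt).ne'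
    refine ⟨t', _, ht'.symm, h.offset _ a b t' ha hb ht'.symm, ?_⟩
    have hocc : a.occ = ((t + o : ℝ) : WithBot ℝ) := by rw [Transition.occ, hat, hao]; rfl
    rw [hocc]
    -- As `t' > t`, the argument `t' - (t + o)` exceeds `-o`, and by induction `-o` is at least
    -- minus the limit for the direction `a.x`, which is `!b.x`.
    refine C.inv.δ_le_lim ?_
    rw [hat, ← ht'] at hlt
    have : t < t' := by exact_mod_cast hlt
    rw [hx, Bool.not_not]
    linarith

theorem offset_succ (h : C.IsDelayOutput ug s) (hw : IsWST ug) {n : ℕ} {a b : Transition}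
    (ha : s.get? (n + 1) = some a) (hb : s.get? (n + 2) = some b) :
    ∃ t o t' : ℝ, a.t = t ∧ a.o = o ∧ b.t = t' ∧ t < t' ∧ b.x = (!a.x) ∧
      b.o = (C.inv.δ b.x (t' - (t + o)) : ℝ) ∧ -C.inv.lim (!b.x) < t' - (t + o) := by
  obtain ⟨t, o, hat, hao, hle⟩ := h.offset_le hw n a ha
  have hlt := (h.isWST hw).increasing (n + 1) _ _ (scheduled_get?_of ha) (scheduled_get?_of hb)
  have hx := (h.isWST hw).alternating (n + 1) _ _ (scheduled_get?_of ha) (scheduled_get?_of hb)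
  simp only at hlt hx
  obtain ⟨t', ht'⟩ := WithBot.ne_bot_iff_exists.1 (bot_le.trans_lt hlt).ne'
  have hocc : a.occ = ((t + o : ℝ) : WithBot ℝ) := by rw [Transition.occ, hat, hao]; rfl
  rw [hat, ← ht'] at hlt
  have hlt' : t < t' := by exact_mod_cast hlt
  refine ⟨t, o, t', hat, hao, ht'.symm, hlt', hx, ?_, ?_⟩
  · rw [h.offset _ a b t' ha hb ht'.symm, hocc]
    rfl
  · rw [hx, Bool.not_not]
    linarith

/-- The involution property orders occurrences at distance two. If `b` comes the time `T` after
`a.occ` and has delay `o₁ = δ(T)`, then the next transition `c`, scheduled at `t₂ > t₁`, has a delay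
greater than `δ(-o₁) = -T`. So it occurs after `t₂ - T`, which is later than `t₁ - T = a.occ`. -/
theorem isTCT (h : C.IsDelayOutput ug s) (hw : IsWST ug) : IsTCT s := by
  refine ⟨h.isWST hw, h.offset_zero, fun n a c ha hc => ?_⟩
  cases n with
  | zero =>
    obtain ⟨x, hx⟩ := h.initial hw
    rw [hx] at ha
    cases ha
    simp [Transition.occ]
  | succ n =>
    obtain ⟨b, hb⟩ := s.ge_stable (Nat.le_succ (n + 2)) hc
    obtain ⟨t, o, t₁, hat, hao, hbt, hlt, hbx, hbo, hdom⟩ := h.offset_succ hw ha hb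
    obtain ⟨t₁', o₁, t₂, hbt', hbo', hct, hlt', hcx, hco, hdom'⟩ := h.offset_succ hw hb hc
    rw [hbt] at hbt'
    rw [hbo] at hbo'
    have e1 : t₁ = t₁' := by exact_mod_cast hbt'
    have e2 : C.inv.δ b.x (t₁ - (t + o)) = o₁ := by exact_mod_cast hbo'
    subst e1
    have hinv := C.inv.involution b.x _ hdom
    have hlim := C.inv.δ_lt_lim hdom
    -- That `-o₁` lies in the domain uses that the limit of a delay function is never attained.
    have hmono := C.inv.strictMono c.x (a := -o₁) (b := t₂ - (t₁ + o₁))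
      (by rw [hcx, Bool.not_not]; simp only [mem_Ioi]; linarith) hdom' (by linarith)
    rw [e2, ← hcx] at hinv
    simp only [Transition.occ]
    rw [hat, hao, hct, hco]
    have : t + o ≤ t₂ + C.inv.δ c.x (t₂ - (t₁ + o₁)) := by linarith
    exact_mod_cast this

/-- If the delay of `b` through the logical channel is below `ε ≤ δ(-ε)`, then by monotonicity its
argument is below `-ε`. This says that the preceding transition occurs later than `b.t + ε`, so `b`
cancels it. The first transition has the limit as its delay, which is at least `δ(-ε)`. -/
theorem causal (h : C.IsDelayOutput ug s) (hw : IsWST ug) {sh : Bool → ℝ} {ε : ℝ}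
    (hε : ∀ x, -(C.inv.thenShift sh).lim (!x) < -ε ∧ ε ≤ (C.inv.thenShift sh).δ x (-ε)) :
    Causal ε (shifter sh s) := by
  intro n a' b' ha' hb'
  obtain ⟨a, ha, -, -, hao'⟩ := exists_of_shifter_get? ha'
  obtain ⟨b, hb, hbt', -, hbo'⟩ := exists_of_shifter_get? hb'
  rw [hao', hbt', hbo']
  cases n with
  | zero =>
    left
    obtain ⟨t, ht, ho⟩ := h.offset_one hw hb
    have h1 := (hε b.x).2.trans ((C.inv.thenShift sh).δ_le_lim (hε b.x).1)
    simp only [Involution.thenShift] at h1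
    rw [Transition.occ, ht, ho]
    have : t + ε ≤ t + C.inv.lim b.x + sh b.x := by linarith
    exact_mod_cast this
  | succ n =>
    obtain ⟨t, o, t', hat, hao, hbt, hlt, hbx, hbo, hdom⟩ := h.offset_succ hw ha hb
    have hax : a.x = !b.x := by rw [hbx, Bool.not_not]
    simp only [Transition.occ]
    rw [hat, hao, hbt, hbo, hax]
    set d := C.inv.δ b.x (t' - (t + o)) with hd
    by_cases hcase : t' + ε ≤ t' + d + sh b.x
    · left
      exact_mod_cast hcase
    · right
      have key : t' + ε < t + o + sh (!b.x) := by
        by_contra hle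
        obtain ⟨h1, h2⟩ := hε b.x
        have h3 := (C.inv.thenShift sh).strictMono b.x |>.monotoneOn (a := -ε)
          (b := t' - (t + o) - sh (!b.x)) h1 (h1.trans_le (by linarith)) (by linarith)
        simp only [Involution.thenShift] at h2 h3
        rw [show t' - (t + o) - sh (!b.x) + sh (!b.x) = t' - (t + o) by ring, ← hd] at h3
        linarith
      have h1 : t' + d + sh b.x ≤ t + o + sh (!b.x) := by linarith
      exact ⟨by exact_mod_cast h1, by exact_mod_cast key.le⟩

end Channel.IsDelayOutput

/-! ### Limits of sequences of signals -/

theorem AgreeUpTo.of_le {r : ℕ → ℝ} (hr : Monotone r) {S : ℕ → TCTSeq}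
    (hS : ∀ k, AgreeUpTo (r k) (S k) (S (k + 1))) {j k : ℕ} (h : j ≤ k) :
    AgreeUpTo (r j) (S j) (S k) := by
  induction k, h using Nat.le_induction with
  | base => exact fun _ _ _ => Iff.rfl
  | succ k hk ih => exact ih.trans ((hS k).mono (hr hk))

/-- Entry `n` of the limit is the entry that some `S k` has there with scheduled time at most `r k`.
It does not depend on `k`, since later signals keep it. Scheduled times increase, so earlier entries
are settled with it and the limit has no gaps. -/
theorem exists_limit {r : ℕ → ℝ} (hr : Monotone r) {S : ℕ → TCTSeq}
    (hw : ∀ k, IsTCT (S k)) (hS : ∀ k, AgreeUpTo (r k) (S k) (S (k + 1))) :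
    ∃ s, ∀ k, AgreeUpTo (r k) (S k) s := by
  classical
  let P : ℕ → Transition → Prop := fun n a => ∃ k, (S k).get? n = some a ∧ a.t ≤ r k
  have huniq : ∀ n a b, P n a → P n b → a = b := by
    rintro n a b ⟨j, hj, haj⟩ ⟨k, hk, hbk⟩
    rcases le_total j k with h | h
    · rw [(AgreeUpTo.of_le hr hS h n a haj).1 hj] at hk
      exact Option.some.inj hk
    · rw [(AgreeUpTo.of_le hr hS h n b hbk).1 hk] at hj
      exact (Option.some.inj hj).symm
  let f : ℕ → Option Transition := fun n => if h : ∃ a, P n a then some h.choose else none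
  have hf : ∀ n a, f n = some a ↔ P n a := by
    intro n a
    by_cases h : ∃ a, P n a
    · simp only [f, dif_pos h, Option.some.injEq]
      exact ⟨fun e => e ▸ h.choose_spec, fun ha => huniq _ _ _ h.choose_spec ha⟩
    · simp only [f, dif_neg h, reduceCtorEq, false_iff]
      exact fun ha => h ⟨a, ha⟩
  have hseq : Stream'.IsSeq f := by
    intro n hn
    change f n = none at hn
    by_contra hne
    obtain ⟨a, ha⟩ := Option.ne_none_iff_exists'.1 hne
    obtain ⟨k, hk, hak⟩ := (hf _ _).1 ha
    obtain ⟨b, hb⟩ := (S k).ge_stable (Nat.le_succ n) hk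
    have := (hf n b).2 ⟨k, hb, ((hw k).lt_of_lt (Nat.lt_succ_self n) hb hk).le.trans hak⟩
    rw [hn] at this
    exact absurd this (by simp)
  refine ⟨⟨f, hseq⟩, fun k n a hak => ?_⟩
  change _ ↔ f n = some a
  rw [hf]
  refine ⟨fun h => ⟨k, h, hak⟩, ?_⟩
  rintro ⟨j, hj, haj⟩
  rcases le_total j k with h | h
  · exact (AgreeUpTo.of_le hr hS h n a haj).1 hj
  · exact (AgreeUpTo.of_le hr hS h n a hak).2 hj

section Limit

variable {r : ℕ → ℝ} {S : ℕ → TCTSeq} {s : TCTSeq}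

theorem eventually_get?_eq (hr : Tendsto r atTop atTop) (h : ∀ k, AgreeUpTo (r k) (S k) s)
    {n : ℕ} {a : Transition} (ha : s.get? n = some a) : ∀ᶠ k in atTop, (S k).get? n = some a := by
  obtain ⟨T, hT⟩ := WithBot.exists_le_coe a.t
  filter_upwards [hr.eventually_ge_atTop T] with k hk
  exact (h k n a (hT.trans (by exact_mod_cast hk))).2 ha

/-- Each condition on finitely many entries can be checked in a single `S k`. For unboundedness, an
infinite limit scheduled up to `L` would fit entirely into one `S k`, which has only finitely many
transitions up to `L`. -/
theorem isTCT_of_limit (hr : Tendsto r atTop atTop) (hw : ∀ k, IsTCT (S k))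
    (h : ∀ k, AgreeUpTo (r k) (S k) s) {x : Bool} (h0 : s.get? 0 = some ⟨⊥, x, 0⟩) : IsTCT s := by
  refine ⟨⟨⟨x, scheduled_get?_of h0⟩, ?_, ?_, ?_⟩, ?_, ?_⟩
  · intro n a b ha hb
    obtain ⟨a, ha', rfl⟩ := exists_of_scheduled_get? ha
    obtain ⟨b, hb', rfl⟩ := exists_of_scheduled_get? hb
    obtain ⟨k, hk1, hk2⟩ := ((eventually_get?_eq hr h ha').and (eventually_get?_eq hr h hb')).exists
    exact (hw k).alternating hk1 hk2
  · intro n a b ha hb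
    obtain ⟨a, ha', rfl⟩ := exists_of_scheduled_get? ha
    obtain ⟨b, hb', rfl⟩ := exists_of_scheduled_get? hb
    obtain ⟨k, hk1, hk2⟩ := ((eventually_get?_eq hr h ha').and (eventually_get?_eq hr h hb')).exists
    exact (hw k).lt_of_lt (Nat.lt_succ_self n) hk1 hk2
  · intro hinf L
    by_contra hbd
    push Not at hbd
    obtain ⟨k, hk⟩ := (hr.eventually_ge_atTop L).exists
    obtain ⟨m, -, hm⟩ := (hw k).exists_count L
    obtain ⟨b, hb⟩ := Option.ne_none_iff_exists'.1 (hinf m)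
    have hbL := hbd m b hb
    obtain ⟨a, ha, rfl⟩ := exists_of_scheduled_get? hb
    have hak := (h k m a (hbL.trans (by exact_mod_cast hk))).2 ha
    exact absurd ((hm m a hak).1 hbL) (lt_irrefl _)
  · intro a ha
    rw [h0] at ha
    cases ha
    rfl
  · intro n a b ha hb
    obtain ⟨k, hk1, hk2⟩ := ((eventually_get?_eq hr h ha).and (eventually_get?_eq hr h hb)).exists
    exact (hw k).occ_le n a b hk1 hk2

theorem causal_shifter_of_limit (hr : Tendsto r atTop atTop)
    (h : ∀ k, AgreeUpTo (r k) (S k) s) {c : Bool → ℝ} {ε : ℝ}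
    (hc : ∀ k, Causal ε (shifter c (S k))) : Causal ε (shifter c s) := by
  intro n a b ha hb
  have h' := fun k => (h k).shifter c
  obtain ⟨k, hk1, hk2⟩ :=
    ((eventually_get?_eq hr h' ha).and (eventually_get?_eq hr h' hb)).exists
  exact hc k n a b hk1 hk2

end Limit

namespace Circuit

variable {Inp Out Chan : Type*} (N : Circuit Inp Out Chan)

/-! ### Collections of signals -/

/-- The signal behind the shifter at a channel input. -/
def pinSignal (W : Inp ⊕ Chan → TCTSeq) (p : N.Pin) : TCTSeq :=
  shifter (N.pinShift p) (W (N.src p))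

/-- The lookahead at a channel input: `ε` if it is fed by a channel, and `0` if it is fed by an
input port. -/
def pinLag (ε : ℝ) (p : N.Pin) : ℝ := Sum.elim (fun _ => 0) (fun _ => ε) (N.src p)

theorem pinLag_nonneg {ε : ℝ} (hε : 0 ≤ ε) (p : N.Pin) : 0 ≤ N.pinLag ε p := by
  unfold pinLag
  cases N.src p with
  | inl i => exact le_rfl
  | inr C => exact hε

/-- All logical channels are strictly causal with margin `ε`. -/
def Margin (ε : ℝ) : Prop :=
  ∀ p C, N.src p = .inr C → ∀ x, -(N.logical C p).lim (!x) < -ε ∧ ε ≤ (N.logical C p).δ x (-ε)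

/-- There are finitely many channel inputs, so the margins of the individual logical channels can be
shrunk to a common one. -/
theorem Compatible.exists_margin {N : Circuit Inp Out Chan} [Finite Chan] (h : N.Compatible) :
    ∃ ε > 0, N.Margin ε := by
  have hp : ∀ p : N.Pin, ∀ᶠ ε in 𝓝[>] (0 : ℝ), ∀ C, N.src p = .inr C →
      ∀ x, -(N.logical C p).lim (!x) < -ε ∧ ε ≤ (N.logical C p).δ x (-ε) := by
    intro p
    cases hsrc : N.src p with
    | inl i => exact Eventually.of_forall fun ε C hC => by cases hC
    | inr C =>
      filter_upwards [(N.logical C p).eventually_margin (h p C hsrc)] with ε hε C' hC'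
      cases hC'
      exact hε
  obtain ⟨ε, h1, h2⟩ := ((eventually_all.2 hp).and self_mem_nhdsWithin).exists
  exact ⟨ε, h2, fun p C hC => h1 p C hC⟩

/-- The properties of the signals of input ports and channels that do not depend on the functions of
the gates. -/
structure IsSignals (u : Inp → TCTSeq) (ε : ℝ) (W : Inp ⊕ Chan → TCTSeq) : Prop where
  inl : ∀ i, W (.inl i) = u i
  tct : ∀ Γ, IsTCT (W Γ)
  init : ∀ Γ, (W Γ).get? 0 = some ⟨⊥, N.init Γ, 0⟩
  nonneg : ∀ Γ n a, (W Γ).get? (n + 1) = some a → ((0 : ℝ) : WithBot ℝ) ≤ a.t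
  causal : ∀ p, Causal (N.pinLag ε p) (N.pinSignal W p)

/-- The channels map the signals `W` to the signals `W'`. -/
def MapsTo (W W' : Inp ⊕ Chan → TCTSeq) : Prop :=
  ∀ C, (N.channel C).Maps (N.init (.inr C)) (fun I => W (N.src ⟨C, I⟩)) (W' (.inr C))

variable {N} {u : Inp → TCTSeq} {ε : ℝ}

theorem AdmissibleInput.causal_pinSignal (hu : N.AdmissibleInput u) {W : Inp ⊕ Chan → TCTSeq}
    (hW : ∀ i, W (.inl i) = u i) {p : N.Pin} {i : Inp} (hp : N.src p = .inl i) :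
    Causal (N.pinLag ε p) (N.pinSignal W p) := by
  intro n a b ha hb
  rw [pinSignal, hp, hW] at ha hb
  have := hu.causal p i hp n a b ha hb
  simpa [pinLag, hp] using this

theorem AdmissibleInput.get?_zero (hu : N.AdmissibleInput u) (i : Inp) :
    (u i).get? 0 = some ⟨⊥, N.init (.inl i), 0⟩ := by
  obtain ⟨x, hx⟩ := (hu.tct i).initial
  rw [hx, ← hu.init i _ hx]

/-- Nothing is assumed about the sequences `ui`: order and causality of a channel output come from
the involution channel alone. This makes the lemma applicable to an arbitrary execution. -/
theorem isSignals_of_maps (hu : N.AdmissibleInput u) (hε : N.Margin ε)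
    {W : Inp ⊕ Chan → TCTSeq} (hW : ∀ i, W (.inl i) = u i)
    (h : ∀ C, ∃ ui, (N.channel C).Maps (N.init (.inr C)) ui (W (.inr C))) :
    N.IsSignals u ε W where
  inl := hW
  tct
    | .inl i => hW i ▸ hu.tct i
    | .inr C => by
      obtain ⟨ui, ug, hg, hd⟩ := h C
      exact hd.isTCT hg.wst
  init
    | .inl i => hW i ▸ hu.get?_zero i
    | .inr C => by
      obtain ⟨ui, ug, hg, hd⟩ := h C
      obtain ⟨x, hx⟩ := hd.initial hg.wst
      have h1 := scheduled_get?_of hx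
      rw [hd.scheduled, hg.initial] at h1
      simp only [Option.some.injEq, Prod.mk.injEq, true_and] at h1
      rw [hx, h1]
  nonneg
    | .inl i => fun n a ha => hu.nonneg i n a (hW i ▸ ha)
    | .inr C => fun n a ha => by
      obtain ⟨ui, ug, hg, hd⟩ := h C
      have h1 := scheduled_get?_of ha
      rw [hd.scheduled] at h1
      exact hg.nonneg n _ h1
  causal p := by
    cases hp : N.src p with
    | inl i => exact hu.causal_pinSignal hW hp
    | inr C =>
      obtain ⟨ui, ug, hg, hd⟩ := h C
      have := hd.causal hg.wst (hε p C hp)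
      rw [pinSignal, hp]
      simpa [pinLag, hp] using this

theorem IsSignals.isOrdered {W : Inp ⊕ Chan → TCTSeq} (hW : N.IsSignals u ε W) (p : N.Pin) :
    IsOrdered (N.pinSignal W p) :=
  (hW.tct _).isOrdered_shifter _

theorem IsSignals.exists_mapsTo (hu : N.AdmissibleInput u) (hε0 : 0 ≤ ε) (hε : N.Margin ε)
    {W : Inp ⊕ Chan → TCTSeq} (hW : N.IsSignals u ε W) :
    ∃ W', N.IsSignals u ε W' ∧ N.MapsTo W W' := by
  have hex : ∀ C, ∃ s, (N.channel C).Maps (N.init (.inr C)) (fun I => W (N.src ⟨C, I⟩)) s := by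
    intro C
    obtain ⟨ug, hug⟩ := (N.channel C).exists_isGateOutput (N.init (.inr C))
      (fun I => N.pinSignal W ⟨C, I⟩) (fun I => hW.isOrdered ⟨C, I⟩)
      fun I => ⟨_, N.pinLag_nonneg hε0 ⟨C, I⟩, hW.causal ⟨C, I⟩⟩
    obtain ⟨s, hs⟩ := (N.channel C).exists_isDelayOutput ug
    exact ⟨s, ug, hug, hs⟩
  choose s hs using hex
  exact ⟨Sum.elim u s, isSignals_of_maps hu hε (fun i => rfl) fun C => ⟨_, hs C⟩, hs⟩

/-- The outputs of all channels agree for the time `ε` longer than their inputs. -/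
theorem MapsTo.agreeUpTo (hε0 : 0 ≤ ε) {W₁ W₂ W₁' W₂' : Inp ⊕ Chan → TCTSeq}
    (h₁ : N.IsSignals u ε W₁) (h₂ : N.IsSignals u ε W₂) (hm₁ : N.MapsTo W₁ W₁')
    (hm₂ : N.MapsTo W₂ W₂') {T : ℝ} (h : ∀ Γ, AgreeUpTo T (W₁ Γ) (W₂ Γ)) (C : Chan) :
    AgreeUpTo (T + ε) (W₁' (.inr C)) (W₂' (.inr C)) := by
  have key : ∀ {W₁ W₂ W₁' W₂' : Inp ⊕ Chan → TCTSeq}, N.IsSignals u ε W₁ → N.IsSignals u ε W₂ →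
      N.MapsTo W₁ W₁' → N.MapsTo W₂ W₂' → (∀ Γ, AgreeUpTo T (W₁ Γ) (W₂ Γ)) →
      ∀ n (a : Transition), a.t ≤ ((T + ε : ℝ) : WithBot ℝ) →
        (W₁' (.inr C)).get? n = some a → (W₂' (.inr C)).get? n = some a := by
    intro W₁ W₂ W₁' W₂' h₁ h₂ hm₁ hm₂ h n a haT ha
    obtain ⟨ug₁, hg₁, hd₁⟩ := hm₁ C
    obtain ⟨ug₂, hg₂, hd₂⟩ := hm₂ C
    refine hd₁.get?_eq hd₂ hg₁.wst (T := T + ε) ?_ n a ha haT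
    refine hg₁.wst.get?_of_state hg₂.wst (by rw [hg₁.initial, hg₂.initial]) hg₁.nonneg hg₂.nonneg
      fun t ht htT => ?_
    obtain ⟨v₁, hv₁, hs₁⟩ := hg₁.state t ht
    obtain ⟨v₂, hv₂, hs₂⟩ := hg₂.state t ht
    have hv : v₁ = v₂ := by
      funext I
      set p : N.Pin := ⟨C, I⟩ with hp
      have e₁ : TCTState (N.pinSignal W₁ p) t (v₁ I) := hv₁ I
      have e₂ : TCTState (N.pinSignal W₂ p) t (v₂ I) := hv₂ I
      -- Behind an input port there is no lookahead, but there both signals are the same at all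
      -- times. The gain of `ε` comes from inputs fed by channels.
      cases hsrc : N.src p with
      | inl i =>
        have : N.pinSignal W₁ p = N.pinSignal W₂ p := by
          rw [pinSignal, pinSignal, hsrc, h₁.inl, h₂.inl]
        rw [this] at e₁
        exact e₁.unique e₂
      | inr D =>
        have hlag : N.pinLag ε p = ε := by rw [pinLag, hsrc]; rfl
        obtain ⟨v, a₁, a₂⟩ := ((h (N.src p)).shifter (N.pinShift p)).exists_tctState
          (h₁.isOrdered p) (h₂.isOrdered p) hε0 (hlag ▸ h₁.causal p) (hlag ▸ h₂.causal p) htT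
        rw [e₁.unique a₁, e₂.unique a₂]
    exact ⟨_, hs₁, hv ▸ hs₂⟩
  exact fun n a ha => ⟨key h₁ h₂ hm₁ hm₂ h n a ha, key h₂ h₁ hm₂ hm₁ (fun Γ => (h Γ).symm) n a ha⟩

/-- The base of the inductions in steps of `ε`. The bound `-1` stands for any negative time. -/
theorem IsSignals.agreeUpTo_neg {W₁ W₂ : Inp ⊕ Chan → TCTSeq} (h₁ : N.IsSignals u ε W₁)
    (h₂ : N.IsSignals u ε W₂) (Γ : Inp ⊕ Chan) : AgreeUpTo (-1) (W₁ Γ) (W₂ Γ) := by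
  intro n a ha
  cases n with
  | zero => rw [h₁.init, h₂.init]
  | succ n =>
    have hneg : ¬ ((0 : ℝ) : WithBot ℝ) ≤ a.t := fun h => by
      have h' := h.trans ha
      have : (0 : ℝ) ≤ -1 := by exact_mod_cast h'
      linarith
    exact ⟨fun h => absurd (h₁.nonneg Γ n a h) hneg, fun h => absurd (h₂.nonneg Γ n a h) hneg⟩

theorem MapsTo.agreeUpTo_all (hε0 : 0 ≤ ε) {W₁ W₂ W₁' W₂' : Inp ⊕ Chan → TCTSeq}
    (h₁ : N.IsSignals u ε W₁) (h₂ : N.IsSignals u ε W₂) (h₁' : N.IsSignals u ε W₁')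
    (h₂' : N.IsSignals u ε W₂') (hm₁ : N.MapsTo W₁ W₁')
    (hm₂ : N.MapsTo W₂ W₂') {T : ℝ} (h : ∀ Γ, AgreeUpTo T (W₁ Γ) (W₂ Γ)) (Γ : Inp ⊕ Chan) :
    AgreeUpTo (T + ε) (W₁' Γ) (W₂' Γ) := by
  cases Γ with
  | inl i => rw [h₁'.inl, h₂'.inl]; exact fun _ _ _ => Iff.rfl
  | inr C => exact hm₁.agreeUpTo hε0 h₁ h₂ hm₂ h C

theorem eq_of_agreeUpTo (hε : 0 < ε) {W₁ W₂ : Inp ⊕ Chan → TCTSeq}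
    (h : ∀ k : ℕ, ∀ Γ, AgreeUpTo (-1 + k * ε) (W₁ Γ) (W₂ Γ)) : W₁ = W₂ := by
  funext Γ
  refine AgreeUpTo.eq_of_forall fun T => ?_
  obtain ⟨k, hk⟩ := exists_nat_ge ((T + 1) / ε)
  refine (h k Γ).mono ?_
  rw [div_le_iff₀ hε] at hk
  linarith

/-- Fixed points are their own images, so every application of the channels prolongs their agreement
by `ε`. -/
theorem MapsTo.unique (hε : 0 < ε) {W₁ W₂ : Inp ⊕ Chan → TCTSeq}
    (h₁ : N.IsSignals u ε W₁) (h₂ : N.IsSignals u ε W₂) (hm₁ : N.MapsTo W₁ W₁)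
    (hm₂ : N.MapsTo W₂ W₂) : W₁ = W₂ := by
  refine eq_of_agreeUpTo hε fun k => ?_
  induction k with
  | zero => simpa using h₁.agreeUpTo_neg h₂
  | succ k ih =>
    intro Γ
    have := hm₁.agreeUpTo_all hε.le h₁ h₂ h₁ h₂ hm₂ ih Γ
    rwa [show -1 + ((k + 1 : ℕ) : ℝ) * ε = -1 + k * ε + ε by push_cast; ring]

/-- A starting point for the iteration, in which no channel ever switches. -/
theorem exists_isSignals (hu : N.AdmissibleInput u) :
    ∃ W : Inp ⊕ Chan → TCTSeq, N.IsSignals u ε W := by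
  let c : Chan → TCTSeq := fun C => Stream'.Seq.cons ⟨⊥, N.init (.inr C), 0⟩ Stream'.Seq.nil
  have hc0 : ∀ C, (c C).get? 0 = some ⟨⊥, N.init (.inr C), 0⟩ := fun C => rfl
  have hc : ∀ C n, (c C).get? (n + 1) = none := fun C n => rfl
  have hsch : ∀ C n a, (TCTSeq.scheduled (c C)).get? (n + 1) ≠ some a := by
    intro C n a h
    rw [scheduled_get?, hc] at h
    simp at h
  refine ⟨Sum.elim u c, fun i => rfl, ?_, ?_, ?_, ?_⟩
  · rintro (i | C)
    · exact hu.tct i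
    · rw [Sum.elim_inr]
      refine ⟨⟨⟨_, scheduled_get?_of (hc0 C)⟩, fun n a b _ hb => absurd hb (hsch C n b),
        fun n a b _ hb => absurd hb (hsch C n b), fun h => absurd ?_ (h 1)⟩, fun a ha => ?_,
        fun n a b _ hb => ?_⟩
      · rw [scheduled_get?, hc]; rfl
      · rw [hc0] at ha
        cases ha
        rfl
      · rw [hc C (n + 1)] at hb
        simp at hb
  · rintro (i | C)
    · exact hu.get?_zero i
    · exact hc0 C
  · rintro (i | C) n a ha
    · exact hu.nonneg i n a ha
    · rw [Sum.elim_inr, hc] at ha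
      simp at ha
  · intro p
    cases hp : N.src p with
    | inl i => exact hu.causal_pinSignal (fun i => rfl) hp
    | inr C =>
      intro n a b _ hb
      rw [pinSignal, hp, Sum.elim_inr, shifter_get?, hc] at hb
      simp at hb

/-- Consecutive iterates agree up to `r k = -1 + k * ε`, a bound that grows by `ε` per step, so they
converge. The limit `W` agrees with iterate `k` up to `r k`, hence its image agrees with iterate `k
+ 1`, and so with `W`, up to `r (k + 1)`. -/
theorem exists_fixedPoint (hu : N.AdmissibleInput u) (hε0 : 0 < ε) (hε : N.Margin ε) :
    ∃ W : Inp ⊕ Chan → TCTSeq, N.IsSignals u ε W ∧ N.MapsTo W W := by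
  obtain ⟨W₀, hW₀⟩ := exists_isSignals (ε := ε) hu
  choose Φ hΦ hΦm using
    fun W : {W : Inp ⊕ Chan → TCTSeq // N.IsSignals u ε W} => W.2.exists_mapsTo hu hε0.le hε
  let S : ℕ → {W : Inp ⊕ Chan → TCTSeq // N.IsSignals u ε W} :=
    fun k => Nat.rec ⟨W₀, hW₀⟩ (fun _ W => ⟨Φ W, hΦ W⟩) k
  have hSm : ∀ k, N.MapsTo (S k).1 (S (k + 1)).1 := fun k => hΦm (S k)
  let r : ℕ → ℝ := fun k => -1 + k * ε
  have hr1 : ∀ k, r (k + 1) = r k + ε := fun k => by simp only [r]; push_cast; ring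
  have hr : Monotone r := monotone_nat_of_le_succ fun k => by rw [hr1]; linarith
  have hrt : Tendsto r atTop atTop :=
    tendsto_atTop_add_const_left _ _ (tendsto_natCast_atTop_atTop.atTop_mul_const hε0)
  have hS : ∀ k Γ, AgreeUpTo (r k) ((S k).1 Γ) ((S (k + 1)).1 Γ) := by
    intro k
    induction k with
    | zero => simpa [r] using (S 0).2.agreeUpTo_neg (S 1).2
    | succ k ih =>
      rw [hr1]
      exact (hSm k).agreeUpTo_all hε0.le (S k).2 (S (k + 1)).2 (S (k + 1)).2 (S (k + 2)).2
        (hSm (k + 1)) ih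
  choose W hW using fun Γ => exists_limit hr (fun k => (S k).2.tct Γ) (fun k => hS k Γ)
  have hW0 : ∀ Γ, (W Γ).get? 0 = some ⟨⊥, N.init Γ, 0⟩ := fun Γ =>
    (hW Γ 0 0 _ bot_le).1 ((S 0).2.init Γ)
  have hWs : N.IsSignals u ε W := by
    refine ⟨fun i => ?_, fun Γ => ?_, hW0, fun Γ n a ha => ?_, fun p => ?_⟩
    · refine AgreeUpTo.eq_of_forall fun T => ?_
      obtain ⟨k, hk⟩ := (hrt.eventually_ge_atTop T).exists
      have := (hW (.inl i) k).mono hk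
      rw [(S k).2.inl] at this
      exact this.symm
    · exact isTCT_of_limit hrt (fun k => (S k).2.tct Γ) (hW Γ) (hW0 Γ)
    · obtain ⟨k, hk⟩ := (eventually_get?_eq hrt (hW Γ) ha).exists
      exact (S k).2.nonneg Γ n a hk
    · exact causal_shifter_of_limit hrt (hW (N.src p)) fun k => (S k).2.causal p
  obtain ⟨W', hWs', hm⟩ := hWs.exists_mapsTo hu hε0.le hε
  have hWW : W' = W := by
    refine eq_of_agreeUpTo hε0 fun k => ?_
    cases k with
    | zero => simpa using hWs'.agreeUpTo_neg hWs
    | succ k =>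
      intro Γ
      have h1 := hm.agreeUpTo_all hε0.le hWs (S k).2 hWs' (S (k + 1)).2 (hSm k)
        (fun Γ => (hW Γ k).symm) Γ
      rw [← hr1] at h1
      exact h1.trans (hW Γ (k + 1))
  exact ⟨W, hWs, hWW ▸ hm⟩

end Circuit

/-! ### States of prefixes and values of simulator signals. -/

theorem PartState.succ_self {s : TCTSeq} {k : ℕ} {t : ℝ} {b : Transition}
    (hb : s.get? k = some b) (h1 : b.t ≤ t) (h2 : b.occ ≤ t) : PartState s (k + 1) t b.x :=
  ⟨k, b, Nat.lt_succ_self k, hb, rfl, h1, h2, fun m _ _ => by omega⟩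

/-- Together with `PartState.succ_self` this mirrors `Driver.value_sched_of_lt` and
`Driver.value_sched_of_le`: one more transition overrides everything once it has taken effect and
changes nothing before. -/
theorem PartState.succ_of_not {s : TCTSeq} {k : ℕ} {t : ℝ} {v : Bool} (h : PartState s k t v)
    (hk : ∀ b, s.get? k = some b → b.t ≤ t → ¬ b.occ ≤ t) : PartState s (k + 1) t v := by
  obtain ⟨n, a, hnk, ha, hv, hat, hao, hmax⟩ := h
  refine ⟨n, a, by omega, ha, hv, hat, hao, fun m hm hmk b hb => ?_⟩
  rcases (Nat.lt_succ_iff.1 hmk).eq_or_lt with e | e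
  · subst e
    exact hk b hb
  · exact hmax m hm e b hb

namespace Driver

theorem value_sched_of_le (D : Driver) {t t' : ℝ} (x : Bool) (h : t ≤ t') :
    (D.sched t x).value t' = x := by
  simp [value, sched, List.filter_append, h]

theorem value_sched_of_lt (D : Driver) {t t' : ℝ} (x : Bool) (h : t' < t) :
    (D.sched t x).value t' = D.value t' := by
  classical
  have : ∀ e : ℝ × Bool, (decide (e.1 ≤ t') && decide (e.1 < t)) = decide (e.1 ≤ t') := by
    intro e
    by_cases he : e.1 ≤ t'
    · simp [he, he.trans_lt h]
    · simp [he]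
  simp [value, sched, List.filter_append, not_le.2 h, this]

theorem value_of_lt (D : Driver) {t : ℝ} (h : ∀ e ∈ D.pend, t < e.1) : D.value t = D.cur := by
  have : D.pend.filter (fun e => e.1 ≤ t) = [] :=
    List.filter_eq_nil_iff.2 fun e he => by simpa using h e he
  simp [value, this]

/-- The head of the list turns from an entry into the default value, which is the same from its time
on. Invariants stated through `value` therefore survive the processing of an event. -/
theorem value_advance (D : Driver) {t t' : ℝ} (h : D.pend.head?.map Prod.fst = some t)
    (ht : t ≤ t') : D.advance.value t' = D.value t' := by
  obtain ⟨cur, pend⟩ := D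
  cases pend with
  | nil => simp at h
  | cons e l =>
    obtain ⟨s, x⟩ := e
    simp only [List.head?_cons, Option.map_some, Option.some.injEq] at h
    subst h
    simp only [value, advance, ht, List.filter_cons_of_pos, decide_true, List.getLast?_cons]
    cases (l.filter fun e => e.1 ≤ t').getLast? <;> rfl

theorem advance_pend (D : Driver) : D.advance.pend = D.pend.tail := by
  obtain ⟨cur, pend⟩ := D
  cases pend <;> rfl

theorem length_advance_lt (D : Driver) {t : ℝ} (h : D.pend.head?.map Prod.fst = some t) :
    D.advance.pend.length < D.pend.length := by
  rw [advance_pend]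
  cases hp : D.pend with
  | nil => simp [hp] at h
  | cons e l => simp

end Driver

namespace Circuit

variable {Inp Out Chan : Type*} {N : Circuit Inp Out Chan}

/-- For a gate that is neither inverter nor buffer, `calcDelta` ignores the direction; this is right
only because supported channels have `Δ⁺ = Δ⁻` there. -/
theorem Supported.calcDelta_eq (hN : N.Supported) (p : N.Pin) (x : Bool) :
    calcDelta (N.channel p.1) x ((N.channel p.1).Δ p.2 true) ((N.channel p.1).Δ p.2 false) =
      N.pinShift p x := by
  unfold calcDelta pinShift Channel.inShift
  by_cases h1 : (N.channel p.1).IsNot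
  · cases x <;> simp [h1]
  · by_cases h2 : (N.channel p.1).IsId
    · cases x <;> simp [h1, h2]
    · cases x <;> simp [h1, h2, hN p.1 h1 h2 p.2]

/-! ### The invariant of the simulation -/

/-- The part of the invariant at time `t` that concerns the files and the signals `evTI` and
`evGI`, relative to the signals `W` of the execution. -/
structure SimInv (W : Inp ⊕ Chan → TCTSeq) (st : N.SimState) (t : ℝ) : Prop where
  nonneg : 0 ≤ t
  pos : ∀ Γ, 0 < (st.F Γ).length
  pre : ∀ Γ (n : ℕ) (a : Transition), (st.F Γ)[n]? = some a → (W Γ).get? n = some a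
  le : ∀ Γ (n : ℕ) (a : Transition), (st.F Γ)[n]? = some a → a.t ≤ t
  complete : ∀ Γ n (a : Transition), (W Γ).get? n = some a → a.t < t → n < (st.F Γ).length
  ti : ∀ p, (st.ti p).pend = [] ∨ (st.ti p).pend = [(t, !(st.ti p).cur)] ∧
    ∃ a : Transition, (st.F (N.src p)).getLast? = some a ∧ a.t = t
  gi_sorted : ∀ p, (st.gi p).pend.Pairwise fun a b => a.1 < b.1
  gi_ge : ∀ p, ∀ e ∈ (st.gi p).pend, t ≤ e.1
  -- A pending `evTI`, of which there is at most one, means that the last entry of the file has not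
  -- yet been passed on to this input.
  gi_state : ∀ p t', t ≤ t' → PartState (N.pinSignal W p)
    ((st.F (N.src p)).length - (st.ti p).pend.length) t' ((st.gi p).value t')

/-- The part of the invariant that concerns the signal `evGO(C)`. -/
structure GateInv (W : Inp ⊕ Chan → TCTSeq) (st : N.SimState) (t : ℝ) (C : Chan) : Prop where
  pend : (st.go C).pend = [] ∨ ∃ b, (st.go C).pend = [(t, b)]
  cur : (st.F (.inr C)).getLast?.map Transition.x = some (st.go C).cur
  -- The second alternative is needed because `procGI` evaluates the gate on `value t`, which
  -- anticipates changes of other inputs scheduled for `t` but not yet processed.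
  value : (st.go C).value t = (N.channel C).f (fun I => (st.gi ⟨C, I⟩).cur) ∨
    WSTState (TCTSeq.scheduled (W (.inr C))) t ((st.go C).value t)

variable {u : Inp → TCTSeq} {ε : ℝ} {W : Inp ⊕ Chan → TCTSeq} {st : N.SimState} {t : ℝ}

theorem MapsTo.wstState (hm : N.MapsTo W W) (ht : 0 ≤ t) {C : Chan}
    {v : Fin (N.channel C).d → Bool} (hv : ∀ I, TCTState (N.pinSignal W ⟨C, I⟩) t (v I)) :
    WSTState (TCTSeq.scheduled (W (.inr C))) t ((N.channel C).f v) := by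
  obtain ⟨ug, hg, hd⟩ := hm C
  obtain ⟨v', hv', hs⟩ := hg.state t ht
  have : v = v' := funext fun I => (hv I).unique (hv' I)
  rw [hd.scheduled, this]
  exact hs

namespace SimInv

theorem getLast_get? (h : SimInv W st t) {Γ : Inp ⊕ Chan} {a : Transition}
    (ha : (st.F Γ).getLast? = some a) : (W Γ).get? ((st.F Γ).length - 1) = some a ∧ a.t ≤ t := by
  rw [List.getLast?_eq_getElem?] at ha
  exact ⟨h.pre _ _ _ ha, h.le _ _ _ ha⟩

/-- A transition that is not yet recorded is not in the past. -/
theorem le_of_length_le (h : SimInv W st t) {Γ : Inp ⊕ Chan} {n : ℕ} {a : Transition}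
    (ha : (W Γ).get? n = some a) (hn : (st.F Γ).length ≤ n) : (t : WithBot ℝ) ≤ a.t :=
  not_lt.1 fun hlt => absurd (h.complete Γ n a ha hlt) (not_lt.2 hn)

theorem le_of_due (hW : N.IsSignals u ε W) (h : SimInv W st t) (hg : ∀ C, GateInv W st t C)
    {ev : N.Event} {s : ℝ} (hd : N.Due u st ev s) : t ≤ s := by
  cases ev with
  | ext i =>
    obtain ⟨a, ha, hs⟩ := hd
    rw [← hW.inl] at ha
    have := h.le_of_length_le ha le_rfl
    rw [hs] at this
    exact_mod_cast this
  | ti p =>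
    rcases h.ti p with e | ⟨e, -⟩ <;> simp [Due, e] at hd
    exact hd.le
  | gi p =>
    cases e : (st.gi p).pend with
    | nil => simp [Due, e] at hd
    | cons b l =>
      simp only [Due, e, List.head?_cons, Option.map_some, Option.some.injEq] at hd
      exact hd ▸ h.gi_ge p b (by simp [e])
  | go C =>
    rcases (hg C).pend with e | ⟨b, e⟩ <;> simp [Due, e] at hd
    exact hd.le

/-- If no events of input ports and transition indicators are left up to time `t'`, the signals
`evGI` have the states of the execution at `t'`. -/
theorem tctState (hW : N.IsSignals u ε W) (hε : 0 < ε) (h : SimInv W st t) {t' : ℝ} (ht : t ≤ t')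
    (hext : ∀ i s, N.Due u st (.ext i) s → t' < s) (hti : ∀ p, (st.ti p).pend = [])
    (hC : ∀ C n a, (W (.inr C)).get? n = some a → a.t < t' → n < (st.F (.inr C)).length)
    (p : N.Pin) : TCTState (N.pinSignal W p) t' ((st.gi p).value t') := by
  have hps := h.gi_state p t' ht
  rw [hti p] at hps
  refine hps.tctState (hW.isOrdered p) (N.pinLag_nonneg hε.le p) (hW.causal p) fun m hm b hb => ?_
  obtain ⟨a, ha, hbt, -⟩ := exists_of_shifter_get? hb
  rw [hbt]
  simp only [List.length_nil, Nat.sub_zero] at hm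
  have hpos : 0 < m := (h.pos (N.src p)).trans_le hm
  obtain ⟨m, rfl⟩ : ∃ k, m = k + 1 := ⟨m - 1, by omega⟩
  obtain ⟨s, hs, -⟩ := WithBot.exists_coe_of_nonneg (hW.nonneg _ _ _ ha)
  rw [hs]
  suffices t' < s + N.pinLag ε p by exact_mod_cast this
  -- Behind a port the lookahead is `0`, so the next external transition has to be strictly later
  -- than `t'`. Behind a channel `t' ≤ s` is enough because `ε > 0`, which is why `evGO` may come
  -- last among simultaneous events.
  cases hsrc : N.src p with
  | inl i =>
    rw [hsrc] at ha hm
    obtain ⟨c, hc⟩ := (W (.inl i)).ge_stable hm ha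
    obtain ⟨k, hk⟩ : ∃ k, (st.F (.inl i)).length = k + 1 :=
      ⟨_, (Nat.succ_pred_eq_of_pos (h.pos _)).symm⟩
    obtain ⟨r, hr, -⟩ := WithBot.exists_coe_of_nonneg (hW.nonneg _ k _ (hk ▸ hc))
    have h1 := hext i r ⟨c, by rw [← hW.inl, hc], hr⟩
    have h2 : r ≤ s := by
      rcases hm.eq_or_lt with e | e
      · rw [e, ha] at hc
        cases hc
        rw [hr] at hs
        exact le_of_eq (by exact_mod_cast hs)
      · have := (hW.tct _).lt_of_lt e hc ha
        rw [hr, hs] at this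
        exact le_of_lt (by exact_mod_cast this)
    simp only [pinLag, hsrc, Sum.elim_inl]
    linarith
  | inr C =>
    rw [hsrc] at ha hm
    simp only [pinLag, hsrc, Sum.elim_inr]
    have : t' ≤ s := by
      by_contra hlt
      have := hC C _ a ha (by rw [hs]; exact_mod_cast not_le.1 hlt)
      omega
    linarith

theorem ti_pend_eq_nil (h : SimInv W st t) {s : ℝ} (hs : t ≤ s) {p : N.Pin}
    (hp : ∀ s', N.Due u st (.ti p) s' → s < s') : (st.ti p).pend = [] := by
  refine (h.ti p).resolve_right fun ⟨e, _⟩ => ?_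
  exact absurd (hp t (by simp [Due, e])) (not_lt.2 hs)

theorem lt_of_mem_gi (h : SimInv W st t) {s : ℝ} {p : N.Pin}
    (hp : ∀ s', N.Due u st (.gi p) s' → s < s') : ∀ e ∈ (st.gi p).pend, s < e.1 := by
  have hsorted := h.gi_sorted p
  cases hpend : (st.gi p).pend with
  | nil => simp
  | cons b l =>
    have hb : s < b.1 := hp b.1 (by simp [Due, hpend])
    rw [hpend, List.pairwise_cons] at hsorted
    intro e he
    rcases List.mem_cons.1 he with rfl | he
    · exact hb
    · exact hb.trans (hsorted.1 e he)

theorem le_of_mem_gi (h : SimInv W st t) {s : ℝ} {p : N.Pin}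
    (hp : ∀ s', N.Due u st (.gi p) s' → s ≤ s') : ∀ e ∈ (st.gi p).pend, s ≤ e.1 := by
  intro e he
  refine le_of_forall_lt fun r hr => ?_
  exact h.lt_of_mem_gi (fun s' hs' => hr.trans_le (hp s' hs')) e he

/-- If no events are left up to time `s`, nothing is missing in the files up to time `s`. -/
theorem lt_length [Finite Chan] (hW : N.IsSignals u ε W) (hm : N.MapsTo W W) (hε : 0 < ε)
    (h : SimInv W st t) (hg : ∀ C, GateInv W st t C) {s : ℝ} (hts : t ≤ s)
    (hdue : ∀ ev s', N.Due u st ev s' → s < s') (Γ : Inp ⊕ Chan) (n : ℕ) (a : Transition)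
    (ha : (W Γ).get? n = some a) (has : a.t ≤ s) : n < (st.F Γ).length := by
  have hsucc : ∀ Γ, ∃ k, (st.F Γ).length = k + 1 := fun Γ =>
    ⟨_, (Nat.succ_pred_eq_of_pos (h.pos _)).symm⟩
  have hfirst : ∀ (Γ : Inp ⊕ Chan) (n : ℕ) (a : Transition), (W Γ).get? n = some a →
      (st.F Γ).length ≤ n → ∃ b, (W Γ).get? (st.F Γ).length = some b ∧ b.t ≤ a.t := by
    intro Γ n a ha hn
    obtain ⟨b, hb⟩ := (W Γ).ge_stable hn ha
    refine ⟨b, hb, ?_⟩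
    rcases hn.eq_or_lt with e | e
    · rw [e, ha] at hb
      cases hb
      exact le_rfl
    · exact ((hW.tct _).lt_of_lt e hb ha).le
  by_contra hn
  rw [not_lt] at hn
  obtain ⟨b, hb, hba⟩ := hfirst Γ n a ha hn
  have hbs := hba.trans has
  cases Γ with
  | inl i =>
    obtain ⟨k, hk⟩ := hsucc (.inl i)
    obtain ⟨r, hr, -⟩ := WithBot.exists_coe_of_nonneg (hW.nonneg _ k b (hk ▸ hb))
    have h1 := hdue (.ext i) r ⟨b, by rw [← hW.inl, hb], hr⟩
    rw [hr] at hbs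
    exact absurd h1 (not_lt.2 (by exact_mod_cast hbs))
  | inr C =>
    clear ha has hn hba n a
    let A : Set Chan := {C | ∃ b, (W (.inr C)).get? (st.F (.inr C)).length = some b ∧ b.t ≤ s}
    let m : Chan → WithBot ℝ := fun C =>
      (((W (.inr C)).get? (st.F (.inr C)).length).map Transition.t).getD ⊥
    -- `C₀` is a channel whose first missing transition is earliest, at time `r`. No channel misses
    -- anything before `r`, so from `t` through `r` the signals `evGI` show true states. With no
    -- event due they are constant there, and the gate of `C₀` has no reason to switch at `r`.
    obtain ⟨C₀, ⟨a, ha, has⟩, hmin⟩ := Set.exists_min_image A m A.toFinite ⟨C, b, hb, hbs⟩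
    obtain ⟨k, hk⟩ := hsucc (.inr C₀)
    obtain ⟨r, hr, hr0⟩ := WithBot.exists_coe_of_nonneg (hW.nonneg _ k a (hk ▸ ha))
    have hrs : r ≤ s := by rw [hr] at has; exact_mod_cast has
    have htr : t ≤ r := by
      have := h.le_of_length_le ha le_rfl
      rw [hr] at this
      exact_mod_cast this
    have hmiss : ∀ C n a, (W (.inr C)).get? n = some a → a.t < r →
        n < (st.F (.inr C)).length := by
      intro C n c hc hcr
      by_contra hn
      obtain ⟨d, hd, hdc⟩ := hfirst _ n c hc (not_lt.1 hn)
      have hdr := hdc.trans_lt hcr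
      have := hmin C ⟨d, hd, hdr.le.trans (by exact_mod_cast hrs)⟩
      simp only [m, ha, hd, Option.map_some, Option.getD_some, hr] at this
      exact absurd hdr (not_lt.2 this)
    have hti : ∀ p, (st.ti p).pend = [] := fun p => h.ti_pend_eq_nil hts (hdue (.ti p))
    have hgi : ∀ p r, r ≤ s → (st.gi p).value r = (st.gi p).cur := fun p r hr =>
      (st.gi p).value_of_lt fun e he => hr.trans_lt (h.lt_of_mem_gi (hdue (.gi p)) e he)
    have hgo : (st.go C₀).pend = [] := by
      refine (hg C₀).pend.resolve_right fun ⟨b, e⟩ => ?_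
      exact absurd (hdue (.go C₀) t (by simp [Due, e])) (not_lt.2 hts)
    have hst : ∀ t', t ≤ t' → t' ≤ r → WSTState (TCTSeq.scheduled (W (.inr C₀))) t'
        ((N.channel C₀).f fun I => (st.gi ⟨C₀, I⟩).cur) := by
      intro t' h1 h2
      have := hm.wstState (h.nonneg.trans h1) (C := C₀) (v := fun I => (st.gi ⟨C₀, I⟩).value t')
        fun I => h.tctState hW hε h1 (fun i s' hs' => (h2.trans hrs).trans_lt (hdue _ _ hs')) hti
          (fun C n a ha hat => hmiss C n a ha (hat.trans_le (by exact_mod_cast h2))) ⟨C₀, I⟩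
      simpa only [hgi _ t' (h2.trans hrs)] using this
    have hcur : (st.go C₀).cur = (N.channel C₀).f fun I => (st.gi ⟨C₀, I⟩).cur := by
      have hv : (st.go C₀).value t = (st.go C₀).cur :=
        (st.go C₀).value_of_lt (by simp [hgo])
      rcases (hg C₀).value with e | e
      · rw [← hv, e]
      · rw [← hv]
        exact e.unique (hst t le_rfl htr)
    -- The last recorded value equals the gate value at `r`, yet the missing transition at `r` would
    -- alternate with it.
    obtain ⟨b, hb, hbx⟩ := Option.map_eq_some_iff.1 (hg C₀).cur
    have hb' := (h.getLast_get? hb).1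
    rw [hk] at ha hb'
    have hx := (hW.tct _).alternating hb' ha
    have hs := (hW.tct (.inr C₀)).wst.state_at (scheduled_get?_of ha) hr
    have := hs.unique (hst r htr le_rfl)
    simp only [hx, hbx, ← hcur] at this
    simp at this

theorem advance_time [Finite Chan] (hW : N.IsSignals u ε W) (hm : N.MapsTo W W) (hε : 0 < ε)
    (h : SimInv W st t) (hg : ∀ C, GateInv W st t C) {t' : ℝ}
    (hdue : ∀ ev s, N.Due u st ev s → t' ≤ s) (htt : t ≤ t') :
    SimInv W st t' ∧ ∀ C, GateInv W st t' C := by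
  rcases htt.eq_or_lt with rfl | hlt
  · exact ⟨h, hg⟩
  have hti : ∀ p, (st.ti p).pend = [] := fun p =>
    h.ti_pend_eq_nil le_rfl fun s hs => hlt.trans_le (hdue (.ti p) s hs)
  have hgo : ∀ C, (st.go C).pend = [] := fun C => by
    refine (hg C).pend.resolve_right fun ⟨b, e⟩ => ?_
    exact absurd (hdue (.go C) t (by simp [Due, e])) (not_le.2 hlt)
  have hcomp : ∀ Γ n a, (W Γ).get? n = some a → a.t < t' → n < (st.F Γ).length := by
    intro Γ n a ha hat
    obtain ⟨s, hs1, hs2⟩ : ∃ s : ℝ, a.t ≤ s ∧ s < t' := by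
      generalize a.t = z at hat
      induction z with
      | bot => exact ⟨t, bot_le, hlt⟩
      | coe r => exact ⟨r, le_rfl, by exact_mod_cast hat⟩
    exact h.lt_length hW hm hε hg (le_max_left t s)
      (fun ev s' hs' => (max_lt hlt hs2).trans_le (hdue ev s' hs')) Γ n a ha
      (hs1.trans (by exact_mod_cast le_max_right t s))
  refine ⟨⟨h.nonneg.trans htt, h.pos, h.pre, fun Γ n a ha => (h.le Γ n a ha).trans
    (by exact_mod_cast htt), hcomp, fun p => .inl (hti p), h.gi_sorted,
    fun p => h.le_of_mem_gi (hdue (.gi p)), fun p s hs => h.gi_state p s (htt.trans hs)⟩,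
    fun C => ⟨.inl (hgo C), (hg C).cur, .inl ?_⟩⟩
  have hv : ∀ s, (st.go C).value s = (st.go C).cur := fun s =>
    (st.go C).value_of_lt (by simp [hgo C])
  rw [hv]
  -- The second alternative refers to the old time `t` and does not carry over. With nothing left to
  -- process at `t`, however, the true state at `t` is the gate value on the current inputs, which
  -- is the first alternative.
  rcases (hg C).value with e | e
  · rw [← e, hv]
  · rw [hv] at e
    have hcur : ∀ p, (st.gi p).value t = (st.gi p).cur := fun p =>
      (st.gi p).value_of_lt fun e he =>
        hlt.trans_le (h.le_of_mem_gi (hdue (.gi p)) e he)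
    have := hm.wstState h.nonneg (C := C) (v := fun I => (st.gi ⟨C, I⟩).value t) fun I =>
      h.tctState hW hε le_rfl (fun i s hs => hlt.trans_le (hdue _ _ hs)) hti
        (fun C n a ha hat => hcomp _ n a ha (hat.trans (by exact_mod_cast hlt))) ⟨C, I⟩
    simp only [hcur] at this
    exact e.unique this

end SimInv

/-! ### Processing of events -/

variable {st' : N.SimState}

/-- What decreases when an event is processed: the number of transitions still to be recorded, or
the number of scheduled transitions of `evTI`, `evGI` or `evGO`, in this order. -/
def Progress (st st' : N.SimState) : Prop :=
  (∃ Γ, (∀ Γ', Γ' ≠ Γ → st'.F Γ' = st.F Γ') ∧ (st'.F Γ).length = (st.F Γ).length + 1) ∨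
  st'.F = st.F ∧ (
    (∃ p, (∀ q, q ≠ p → st'.ti q = st.ti q) ∧
      (st'.ti p).pend.length < (st.ti p).pend.length) ∨
    st'.ti = st.ti ∧ (
      (∃ p, (∀ q, q ≠ p → st'.gi q = st.gi q) ∧
        (st'.gi p).pend.length < (st.gi p).pend.length) ∨
      st'.gi = st.gi ∧ ∃ C, (∀ D, D ≠ C → st'.go D = st.go D) ∧
        (st'.go C).pend.length < (st.go C).pend.length))

theorem SimState.emit_F_self (st : N.SimState) (Γ : Inp ⊕ Chan) (t : ℝ) (a : Transition) :
    (st.emit Γ t a).F Γ = st.F Γ ++ [a] := by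
  simp [SimState.emit]

theorem SimState.emit_F_of_ne (st : N.SimState) {Γ Γ' : Inp ⊕ Chan} (t : ℝ) (a : Transition)
    (h : Γ' ≠ Γ) : (st.emit Γ t a).F Γ' = st.F Γ' := by
  simp [SimState.emit, h]

/-- Recording the next transition preserves the invariant. -/
theorem SimInv.emit (hW : N.IsSignals u ε W) (h : SimInv W st t) {Γ : Inp ⊕ Chan} {a : Transition}
    (ha : (W Γ).get? (st.F Γ).length = some a) (hat : a.t = t) : SimInv W (st.emit Γ t a) t := by
  -- A pending `evTI` would mean that the last entry is scheduled for `t` as well, but scheduled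
  -- times increase strictly. So a toggle never meets another one that it would undo.
  have hnil : ∀ p, N.src p = Γ → (st.ti p).pend = [] := by
    rintro p rfl
    refine (h.ti p).resolve_right fun ⟨_, b, hb, hbt⟩ => ?_
    have hpos := h.pos (N.src p)
    have := (hW.tct _).lt_of_lt (show (st.F (N.src p)).length - 1 < (st.F (N.src p)).length by omega)
      (h.getLast_get? hb).1 ha
    rw [hbt, hat] at this
    exact lt_irrefl _ this
  have hget : ∀ (n : ℕ) (b : Transition), (st.F Γ ++ [a])[n]? = some b →
      (st.F Γ)[n]? = some b ∨ (n = (st.F Γ).length ∧ b = a) := by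
    intro n b hb
    rcases lt_trichotomy n (st.F Γ).length with hn | hn | hn
    · left
      rwa [List.getElem?_append_left hn] at hb
    · right
      subst hn
      simp at hb
      exact ⟨rfl, hb.symm⟩
    · rw [List.getElem?_eq_none (by simp; omega)] at hb
      simp at hb
  have htiself : ∀ p, N.src p = Γ → (st.emit Γ t a).ti p = ⟨(st.ti p).cur, [(t, !(st.ti p).cur)]⟩ := by
    intro p hp
    simp [SimState.emit, hp, Driver.toggle, Driver.sched, hnil p hp]
  have htine : ∀ p, N.src p ≠ Γ → (st.emit Γ t a).ti p = st.ti p := by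
    intro p hp
    simp [SimState.emit, hp]
  refine ⟨h.nonneg, fun Γ' => ?_, fun Γ' n b hb => ?_, fun Γ' n b hb => ?_, fun Γ' n b hb hbt => ?_,
    fun p => ?_, h.gi_sorted, h.gi_ge, fun p t' ht' => ?_⟩
  · by_cases e : Γ' = Γ
    · subst e
      simp [SimState.emit_F_self]
    · rw [st.emit_F_of_ne t a e]
      exact h.pos Γ'
  · by_cases e : Γ' = Γ
    · subst e
      rw [SimState.emit_F_self] at hb
      rcases hget n b hb with hb | ⟨rfl, rfl⟩
      · exact h.pre _ _ _ hb
      · exact ha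
    · rw [st.emit_F_of_ne t a e] at hb
      exact h.pre _ _ _ hb
  · by_cases e : Γ' = Γ
    · subst e
      rw [SimState.emit_F_self] at hb
      rcases hget n b hb with hb | ⟨rfl, rfl⟩
      · exact h.le _ _ _ hb
      · exact hat.le
    · rw [st.emit_F_of_ne t a e] at hb
      exact h.le _ _ _ hb
  · have := h.complete Γ' n b hb hbt
    by_cases e : Γ' = Γ
    · subst e
      rw [SimState.emit_F_self, List.length_append]
      omega
    · rwa [st.emit_F_of_ne t a e]
  · by_cases e : N.src p = Γ
    · rw [htiself p e]
      right
      subst e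
      rw [SimState.emit_F_self]
      exact ⟨rfl, a, by simp, hat⟩
    · rw [htine p e, st.emit_F_of_ne t a e]
      exact h.ti p
  · have hps := h.gi_state p t' ht'
    by_cases e : N.src p = Γ
    -- The new entry is compensated by the new pending `evTI`: the prefix seen at this input stays
    -- the same.
    · rw [htiself p e]
      rw [hnil p e] at hps
      subst e
      rw [SimState.emit_F_self]
      change PartState _ _ t' ((st.gi p).value t')
      simpa using hps
    · rw [htine p e, st.emit_F_of_ne t a e]
      exact hps

theorem step_ext (hW : N.IsSignals u ε W) (h : SimInv W st t) (hg : ∀ C, GateInv W st t C)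
    {i : Inp} (hd : N.Due u st (.ext i) t) :
    (SimInv W (N.process u st (.ext i) t) t ∧ ∀ C, GateInv W (N.process u st (.ext i) t) t C) ∧
      Progress st (N.process u st (.ext i) t) := by
  obtain ⟨a, ha, hat⟩ := hd
  have e : N.process u st (.ext i) t = st.emit (.inl i) t a := by
    simp only [process, ha]
  rw [e]
  have hF : ∀ C, (st.emit (.inl i) t a).F (.inr C) = st.F (.inr C) := fun C =>
    st.emit_F_of_ne t a (by simp)
  refine ⟨⟨h.emit hW (by rw [hW.inl, ha]) hat, fun C => ⟨(hg C).pend, ?_, (hg C).value⟩⟩,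
    .inl ⟨.inl i, fun Γ' hΓ => st.emit_F_of_ne t a hΓ, ?_⟩⟩
  · rw [hF]
    exact (hg C).cur
  · rw [SimState.emit_F_self, List.length_append]
    rfl

/-- The time that `procTI` schedules the signal `evGI` for. -/
theorem exists_procTI (hN : N.Supported) {p : N.Pin} {a : Transition}
    (ha : (st.F (N.src p)).getLast? = some a) (t : ℝ) :
    ∃ q, t ≤ q ∧ (∀ s : ℝ, q ≤ s ↔ t ≤ s ∧ a.occ + (N.pinShift p a.x : WithBot ℝ) ≤ s) ∧
      (st.procTI p t).F = st.F ∧ (st.procTI p t).ti = st.ti ∧ (st.procTI p t).go = st.go ∧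
      (st.procTI p t).gi p = (st.gi p).sched q a.x ∧
      ∀ p', p' ≠ p → (st.procTI p t).gi p' = st.gi p' := by
  simp only [SimState.procTI, ha, hN.calcDelta_eq]
  cases hocc : a.occ with
  | bot =>
    refine ⟨t, le_rfl, fun s => by simp, trivial, trivial, trivial, by simp, fun p' hp' => by simp [hp']⟩
  | coe r =>
    refine ⟨max t (r + N.pinShift p a.x), le_max_left _ _, fun s => ?_, trivial, trivial, trivial, by simp,
      fun p' hp' => by simp [hp']⟩
    rw [max_le_iff]
    refine and_congr Iff.rfl ?_
    norm_cast

theorem step_ti (hN : N.Supported) (h : SimInv W st t)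
    (hg : ∀ C, GateInv W st t C) {p : N.Pin} (hd : N.Due u st (.ti p) t) :
    (SimInv W (N.process u st (.ti p) t) t ∧ ∀ C, GateInv W (N.process u st (.ti p) t) t C) ∧
      Progress st (N.process u st (.ti p) t) := by
  obtain ⟨hpend, a, ha, hat⟩ := (h.ti p).resolve_left fun e => by simp [Due, e] at hd
  obtain ⟨st₁, hst₁⟩ : ∃ st₁ : N.SimState, st₁ =
    { st with ti := open Classical in Function.update st.ti p (st.ti p).advance } := ⟨_, rfl⟩
  have hadv : (st.ti p).advance = ⟨!(st.ti p).cur, []⟩ := by simp [Driver.advance, hpend]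
  have e : N.process u st (.ti p) t = st₁.procTI p t := by
    simp [process, hst₁, hadv]
  have hF₁ : st₁.F = st.F := by rw [hst₁]
  have hgi₁ : st₁.gi = st.gi := by rw [hst₁]
  have hgo₁ : st₁.go = st.go := by rw [hst₁]
  have hti₁ : st₁.ti p = ⟨!(st.ti p).cur, []⟩ := by simp [hst₁, hadv]
  have hti₂ : ∀ p', p' ≠ p → st₁.ti p' = st.ti p' := fun p' hp' => by simp [hst₁, hp']
  obtain ⟨q, htq, hq, hF, hti, hgo, hgi, hgi'⟩ := exists_procTI (st := st₁) hN (hF₁ ▸ ha) t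
  rw [hF₁] at hF
  rw [hgo₁] at hgo
  rw [hgi₁] at hgi hgi'
  rw [e]
  have hcur : ∀ p', ((st₁.procTI p t).gi p').cur = (st.gi p').cur := by
    intro p'
    by_cases hp : p' = p
    · subst hp
      rw [hgi]
      rfl
    · rw [hgi' p' hp]
  have hlast := (h.getLast_get? ha).1
  have hpos := h.pos (N.src p)
  refine ⟨⟨⟨h.nonneg, hF ▸ h.pos, hF ▸ h.pre, hF ▸ h.le, hF ▸ h.complete, fun p' => ?_, fun p' => ?_,
    fun p' => ?_, fun p' t' ht' => ?_⟩, fun C => ⟨hgo ▸ (hg C).pend, hF ▸ hgo ▸ (hg C).cur, ?_⟩⟩, ?_⟩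
  · rw [hti, hF]
    by_cases hp : p' = p
    · subst hp
      rw [hti₁]
      exact .inl rfl
    · rw [hti₂ p' hp]
      exact h.ti p'
  · by_cases hp : p' = p
    · subst hp
      rw [hgi]
      refine List.pairwise_append.2 ⟨(h.gi_sorted p').filter _, List.pairwise_singleton _ _, ?_⟩
      intro x hx y hy
      rw [List.mem_singleton.1 hy]
      simpa using (List.mem_filter.1 hx).2
    · rw [hgi' p' hp]
      exact h.gi_sorted p'
  · by_cases hp : p' = p
    · subst hp
      rw [hgi]
      intro x hx
      rcases List.mem_append.1 hx with hx | hx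
      · exact h.gi_ge p' x (List.mem_filter.1 hx).1
      · rw [List.mem_singleton.1 hx]
        exact htq
    · rw [hgi' p' hp]
      exact h.gi_ge p'
  · rw [hti, hF]
    have hps := h.gi_state p' t' ht'
    by_cases hp : p' = p
    · subst hp
      obtain ⟨b, hb, hbt, hbx, hbo⟩ := shifter_get?_of (c := N.pinShift p') hlast
      rw [hat] at hbt
      rw [hti₁, hgi]
      rw [hpend] at hps
      simp only [List.length_nil, List.length_singleton, Nat.sub_zero] at hps ⊢
      -- Since `b` is scheduled at the current time, `q` is exactly the time from which `b` counts
      -- for `PartState`; scheduling `evGI` for `q` thus lengthens the prefix by one.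
      have hq' : q ≤ t' ↔ b.t ≤ t' ∧ b.occ ≤ t' := by
        rw [hq, hbt, hbo]
        exact and_congr (by norm_cast) Iff.rfl
      obtain ⟨k, hk⟩ : ∃ k, (st.F (N.src p')).length = k + 1 :=
        ⟨_, (Nat.succ_pred_eq_of_pos hpos).symm⟩
      rw [hk] at hb hps ⊢
      by_cases hqt : q ≤ t'
      · rw [Driver.value_sched_of_le _ _ hqt, ← hbx]
        exact PartState.succ_self hb (hq'.1 hqt).1 (hq'.1 hqt).2
      · rw [Driver.value_sched_of_lt _ _ (not_le.1 hqt)]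
        refine hps.succ_of_not fun c hc h1 h2 => ?_
        have hbc : b = c := Option.some.inj (hb.symm.trans hc)
        subst hbc
        exact hqt (hq'.2 ⟨h1, h2⟩)
    · rw [hti₂ p' hp, hgi' p' hp]
      exact hps
  · simp only [hcur, hgo]
    exact (hg C).value
  · refine .inr ⟨hF, .inl ⟨p, fun q hq => by rw [hti, hti₂ q hq], ?_⟩⟩
    rw [hti, hti₁, hpend]
    simp

/-- With no external and no `evTI` event left at `t`, the values of `evGI` at `t` are the true input
states. Whenever `procGI` runs, it therefore leaves `evGO` with the true gate state as its value at
`t`. -/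
theorem step_gi (hW : N.IsSignals u ε W) (hm : N.MapsTo W W) (hε : 0 < ε) (h : SimInv W st t)
    (hg : ∀ C, GateInv W st t C) {p : N.Pin} (hd : N.Due u st (.gi p) t)
    (hext : ∀ i s, N.Due u st (.ext i) s → t < s) (hti : ∀ p s, N.Due u st (.ti p) s → t < s) :
    (SimInv W (N.process u st (.gi p) t) t ∧ ∀ C, GateInv W (N.process u st (.gi p) t) t C) ∧
      Progress st (N.process u st (.gi p) t) := by
  obtain ⟨st₁, hst₁⟩ : ∃ st₁ : N.SimState, st₁ =
    { st with gi := open Classical in Function.update st.gi p (st.gi p).advance } := ⟨_, rfl⟩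
  have hF₁ : st₁.F = st.F := by rw [hst₁]
  have hti₁ : st₁.ti = st.ti := by rw [hst₁]
  have hgo₁ : st₁.go = st.go := by rw [hst₁]
  have hgi₁ : st₁.gi p = (st.gi p).advance := by simp [hst₁]
  have hgi₂ : ∀ p', p' ≠ p → st₁.gi p' = st.gi p' := fun p' hp' => by simp [hst₁, hp']
  have hval : ∀ p' s, t ≤ s → (st₁.gi p').value s = (st.gi p').value s := by
    intro p' s hs
    by_cases hp : p' = p
    · subst hp
      rw [hgi₁, Driver.value_advance _ hd hs]
    · rw [hgi₂ p' hp]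
  have hsub : ∀ p', List.Sublist (st₁.gi p').pend (st.gi p').pend := by
    intro p'
    by_cases hp : p' = p
    · subst hp
      rw [hgi₁, Driver.advance_pend]
      exact List.tail_sublist _
    · rw [hgi₂ p' hp]
  have hcore : ∀ st₂ : N.SimState, st₂.F = st.F → st₂.ti = st.ti → st₂.gi = st₁.gi →
      SimInv W st₂ t := by
    intro st₂ e1 e2 e3
    refine ⟨h.nonneg, e1 ▸ h.pos, e1 ▸ h.pre, e1 ▸ h.le, e1 ▸ h.complete, fun p' => ?_, fun p' => ?_,
      fun p' e he => ?_, fun p' t' ht' => ?_⟩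
    · rw [e1, e2]
      exact h.ti p'
    · rw [e3]
      exact (h.gi_sorted p').sublist (hsub p')
    · rw [e3] at he
      exact h.gi_ge p' e ((hsub p').subset he)
    · rw [e1, e2, e3, hval p' t' ht']
      exact h.gi_state p' t' ht'
  have hprog : ∀ st₂ : N.SimState, st₂.F = st.F → st₂.ti = st.ti → st₂.gi = st₁.gi →
      Progress st st₂ := by
    intro st₂ e1 e2 e3
    refine .inr ⟨e1, .inr ⟨e2, .inl ⟨p, fun q hq => by rw [e3, hgi₂ q hq], ?_⟩⟩⟩
    rw [e3, hgi₁]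
    exact Driver.length_advance_lt _ hd
  by_cases hcur : (st.gi p).advance.cur = (st.gi p).cur
  · have e : N.process u st (.gi p) t = st₁ := by
      simp only [process, hcur, ne_eq, not_true_eq_false, if_false, hst₁]
    rw [e]
    refine ⟨⟨hcore st₁ hF₁ hti₁ rfl, fun C => ⟨hgo₁ ▸ (hg C).pend, hF₁ ▸ hgo₁ ▸ (hg C).cur, ?_⟩⟩,
      hprog st₁ hF₁ hti₁ rfl⟩
    have hcur' : ∀ p', (st₁.gi p').cur = (st.gi p').cur := by
      intro p'
      by_cases hp : p' = p
      · subst hp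
        rw [hgi₁, hcur]
      · rw [hgi₂ p' hp]
    simp only [hcur', hgo₁]
    exact (hg C).value
  · obtain ⟨y, hy⟩ : ∃ y, y = (N.channel p.1).f fun I => (st₁.gi ⟨p.1, I⟩).value t := ⟨_, rfl⟩
    have hstate : WSTState (TCTSeq.scheduled (W (.inr p.1))) t y := by
      rw [hy]
      refine hm.wstState h.nonneg fun I => ?_
      rw [hval _ t le_rfl]
      exact h.tctState hW hε le_rfl hext (fun p => h.ti_pend_eq_nil le_rfl (hti p))
        (fun C => h.complete _) _
    have e : N.process u st (.gi p) t = st₁.procGI p t := by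
      simp only [process, hcur, ne_eq, not_false_eq_true, if_true, hst₁]
    have hgate : ∀ st₂ : N.SimState, st₂.F = st.F → st₂.gi = st₁.gi →
        (∀ C, C ≠ p.1 → st₂.go C = st.go C) → (st₂.go p.1).cur = (st.go p.1).cur →
        ((st₂.go p.1).pend = [] ∨ ∃ b, (st₂.go p.1).pend = [(t, b)]) →
        (st₂.go p.1).value t = y → ∀ C, GateInv W st₂ t C := by
      intro st₂ e1 e2 e3 e4 e5 e6 C
      by_cases hC : C = p.1
      · subst hC
        refine ⟨e5, ?_, .inr (e6.symm ▸ hstate)⟩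
        rw [e1, e4]
        exact (hg p.1).cur
      · refine ⟨e3 C hC ▸ (hg C).pend, ?_, ?_⟩
        · rw [e1, e3 C hC]
          exact (hg C).cur
        · have hc : ∀ I, (st₂.gi ⟨C, I⟩).cur = (st.gi ⟨C, I⟩).cur := fun I => by
            rw [e2, hgi₂ _ fun hp => hC (by rw [← hp])]
          simp only [hc, e3 C hC]
          exact (hg C).value
    rw [e]
    by_cases hxy : (st₁.go p.1).value t = y
    · have e' : st₁.procGI p t = st₁ := by
        simp only [SimState.procGI, ← hy, hxy, ne_eq, not_true_eq_false, if_false]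
      rw [e']
      exact ⟨⟨hcore st₁ hF₁ hti₁ rfl, hgate st₁ hF₁ rfl (fun C _ => by rw [hgo₁]) (by rw [hgo₁])
        (by rw [hgo₁]; exact (hg p.1).pend) hxy⟩, hprog st₁ hF₁ hti₁ rfl⟩
    · obtain ⟨st₂, hst₂⟩ : ∃ st₂, st₂ = st₁.procGI p t := ⟨_, rfl⟩
      rw [← hst₂]
      simp only [SimState.procGI, ← hy, hxy, ne_eq, not_false_eq_true, if_true] at hst₂
      have hF₂ : st₂.F = st.F := by rw [hst₂, ← hF₁]
      have hti₂ : st₂.ti = st.ti := by rw [hst₂, ← hti₁]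
      have hgi₂' : st₂.gi = st₁.gi := by rw [hst₂]
      have hgo₂ : st₂.go p.1 = (st.go p.1).sched t y := by simp [hst₂, hgo₁]
      refine ⟨⟨hcore st₂ hF₂ hti₂ hgi₂', hgate st₂ hF₂ hgi₂' (fun C hC => by simp [hst₂, hC, hgo₁])
        (by rw [hgo₂]; rfl) (.inr ⟨y, ?_⟩) (by rw [hgo₂, Driver.value_sched_of_le _ _ le_rfl])⟩,
        hprog st₂ hF₂ hti₂ hgi₂'⟩
      rw [hgo₂]
      rcases (hg p.1).pend with e | ⟨b, e⟩ <;> simp [Driver.sched, e]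

/-- Only `evGO` events are left at `t`, so both alternatives of `GateInv.value` say that the new
value is the true gate state. If it differs from the last recorded value, the execution has a next
transition by time `t`. -/
theorem step_go (hW : N.IsSignals u ε W) (hm : N.MapsTo W W) (hε : 0 < ε) (h : SimInv W st t)
    (hg : ∀ C, GateInv W st t C) {C : Chan} (hd : N.Due u st (.go C) t)
    (hext : ∀ i s, N.Due u st (.ext i) s → t < s) (hti : ∀ p s, N.Due u st (.ti p) s → t < s)
    (hgi : ∀ p s, N.Due u st (.gi p) s → t < s) :
    (SimInv W (N.process u st (.go C) t) t ∧ ∀ D, GateInv W (N.process u st (.go C) t) t D) ∧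
      Progress st (N.process u st (.go C) t) := by
  obtain ⟨b, hpend⟩ := (hg C).pend.resolve_left fun e => by simp [Due, e] at hd
  obtain ⟨st₁, hst₁⟩ : ∃ st₁ : N.SimState, st₁ =
    { st with go := open Classical in Function.update st.go C (st.go C).advance } := ⟨_, rfl⟩
  have hadv : (st.go C).advance = ⟨b, []⟩ := by simp [Driver.advance, hpend]
  have hF₁ : st₁.F = st.F := by rw [hst₁]
  have hti₁ : st₁.ti = st.ti := by rw [hst₁]
  have hgi₁ : st₁.gi = st.gi := by rw [hst₁]
  have hgo₁ : st₁.go C = ⟨b, []⟩ := by simp [hst₁, hadv]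
  have hgo₂ : ∀ D, D ≠ C → st₁.go D = st.go D := fun D hD => by simp [hst₁, hD]
  have hcore : SimInv W st₁ t := by
    refine ⟨h.nonneg, hF₁ ▸ h.pos, hF₁ ▸ h.pre, hF₁ ▸ h.le, hF₁ ▸ h.complete, fun p => ?_,
      hgi₁ ▸ h.gi_sorted, hgi₁ ▸ h.gi_ge, ?_⟩
    · rw [hF₁, hti₁]
      exact h.ti p
    · rw [hF₁, hti₁, hgi₁]
      exact h.gi_state
  have hval : (st.go C).value t = b := by simp [Driver.value, hpend]
  have hstate : WSTState (TCTSeq.scheduled (W (.inr C))) t b := by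
    rw [← hval]
    rcases (hg C).value with e | e
    · rw [e]
      refine hm.wstState h.nonneg fun I => ?_
      rw [← Driver.value_of_lt _ (h.lt_of_mem_gi (hgi ⟨C, I⟩))]
      exact h.tctState hW hε le_rfl hext (fun p => h.ti_pend_eq_nil le_rfl (hti p))
        (fun C => h.complete _) _
    · exact e
  have hvalue₁ : (st₁.go C).value t = b := by rw [hgo₁]; rfl
  by_cases hcur : b = (st.go C).cur
  · have e : N.process u st (.go C) t = st₁ := by
      simp only [process, hadv, hcur, ne_eq, not_true_eq_false, if_false, hst₁]
    rw [e]
    refine ⟨⟨hcore, fun D => ?_⟩, .inr ⟨hF₁, .inr ⟨hti₁, .inr ⟨hgi₁, C, hgo₂, ?_⟩⟩⟩⟩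
    · by_cases hD : D = C
      · subst hD
        refine ⟨.inl (by rw [hgo₁]), ?_, .inr (hvalue₁.symm ▸ hstate)⟩
        rw [hF₁, hgo₁]
        simp only [hcur]
        exact (hg D).cur
      · refine ⟨hgo₂ D hD ▸ (hg D).pend, ?_, ?_⟩
        · rw [hF₁, hgo₂ D hD]
          exact (hg D).cur
        · rw [hgi₁, hgo₂ D hD]
          exact (hg D).value
    · rw [hgo₁, hpend]
      simp
  · obtain ⟨a, ha, hax⟩ := Option.map_eq_some_iff.1 (hg C).cur
    obtain ⟨haW, hat⟩ := h.getLast_get? ha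
    have hwst := (hW.tct (.inr C)).wst
    obtain ⟨c', hc', hct⟩ := hwst.exists_next (scheduled_get?_of haW) hat hstate
      (by simpa [hax] using hcur)
    rw [Nat.sub_add_cancel (h.pos (.inr C))] at hc'
    obtain ⟨c, hc, rfl⟩ := exists_of_scheduled_get? hc'
    -- The transition is not earlier than `t` either, because the file is complete before `t`.
    have hct' : c.t = t := le_antisymm hct (h.le_of_length_le hc le_rfl)
    have hcs := hc
    rw [← Nat.sub_add_cancel (h.pos (.inr C))] at hcs
    have hcx : c.x = b := by
      rw [(hW.tct _).alternating haW hcs, hax]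
      revert hcur
      cases b <;> cases (st.go C).cur <;> simp
    obtain ⟨ug, -, hdelay⟩ := hm C
    have hco := hdelay.offset _ a c t haW hcs hct'
    have e : N.process u st (.go C) t = st₁.emit (.inr C) t c := by
      have e1 : N.process u st (.go C) t = st₁.procGO C t b := by
        simp only [process, hadv, hcur, ne_eq, not_false_eq_true, if_true, hst₁]
      rw [e1]
      simp only [SimState.procGO, hF₁, ha]
      congr 1
      obtain ⟨ct, cx, co⟩ := c
      simp only at hct' hcx hco
      subst hcx hct' hco
      congr 2
      unfold Channel.delay
      -- The shifts by `Δchar` cancel, so the recorded offset does not depend on the pair used to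
      -- tabulate the delay functions.
      rw [add_assoc (elapsed t a.occ), ← WithTop.coe_add, neg_add_cancel, WithTop.coe_zero, add_zero]
      ring
    rw [e]
    refine ⟨⟨hcore.emit hW (by rw [hF₁]; exact hc) hct', fun D => ?_⟩,
      .inl ⟨.inr C, fun Γ' hΓ => by rw [SimState.emit_F_of_ne _ _ _ hΓ, hF₁], ?_⟩⟩
    · by_cases hD : D = C
      · subst hD
        refine ⟨.inl (by change (st₁.go D).pend = []; rw [hgo₁]), ?_, .inr ?_⟩
        · rw [SimState.emit_F_self]
          change _ = some (st₁.go D).cur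
          simp [hgo₁, hcx]
        · change WSTState _ _ ((st₁.go D).value t)
          rw [hvalue₁]
          exact hstate
      · refine ⟨?_, ?_, ?_⟩
        · change (st₁.go D).pend = [] ∨ ∃ b, (st₁.go D).pend = [(t, b)]
          rw [hgo₂ D hD]
          exact (hg D).pend
        · rw [SimState.emit_F_of_ne _ _ _ (by simpa using hD), hF₁]
          change _ = some (st₁.go D).cur
          rw [hgo₂ D hD]
          exact (hg D).cur
        · change (st₁.go D).value t = (N.channel D).f (fun I => (st₁.gi ⟨D, I⟩).cur) ∨
            WSTState _ _ ((st₁.go D).value t)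
          rw [hgi₁, hgo₂ D hD]
          exact (hg D).value
    · rw [SimState.emit_F_self, List.length_append, hF₁]
      rfl

/-- The invariant holds at some time up to `τ`. -/
def Inv (W : Inp ⊕ Chan → TCTSeq) (τ : ℝ) (st : N.SimState) : Prop :=
  ∃ t ≤ τ, SimInv W st t ∧ ∀ C, GateInv W st t C

theorem Step.inv [Finite Chan] (hN : N.Supported) (hW : N.IsSignals u ε W) (hm : N.MapsTo W W)
    (hε : 0 < ε) {τ : ℝ} (h : Inv W τ st) (hs : N.Step u τ st st') :
    Inv W τ st' ∧ Progress st st' := by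
  obtain ⟨t₀, -, h₀, hg₀⟩ := h
  obtain ⟨ev, t, hd, htτ, hmin, rfl⟩ := hs
  obtain ⟨h, hg⟩ := h₀.advance_time hW hm hε hg₀
    (fun ev' s hs => (hmin ev' s hs).elim le_of_lt fun e => e.1.le) (h₀.le_of_due hW hg₀ hd)
  -- The order among simultaneous events is used only here: kinds of lower rank have nothing left at
  -- time `t`.
  have hlt : ∀ ev' s, N.Due u st ev' s → ev'.rank < ev.rank → t < s := fun ev' s hs hr =>
    (hmin ev' s hs).resolve_right fun e => absurd e.2 (not_le.2 hr)
  suffices hall : (SimInv W (N.process u st ev t) t ∧ ∀ C, GateInv W (N.process u st ev t) t C) ∧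
      Progress st (N.process u st ev t) from ⟨⟨t, htτ, hall.1⟩, hall.2⟩
  cases ev with
  | ext i => exact step_ext hW h hg hd
  | ti p => exact step_ti hN h hg hd
  | gi p =>
    exact step_gi hW hm hε h hg hd (fun i s hs => hlt _ s hs (by simp [Event.rank]))
      fun p s hs => hlt _ s hs (by simp [Event.rank])
  | go C =>
    exact step_go hW hm hε h hg hd (fun i s hs => hlt _ s hs (by simp [Event.rank]))
      (fun p s hs => hlt _ s hs (by simp [Event.rank]))
      fun p s hs => hlt _ s hs (by simp [Event.rank])

variable {τ : ℝ}

/-! ### Initialization -/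

theorem simInv_initState (hW : N.IsSignals u ε W) : SimInv W N.initState 0 := by
  have hF : ∀ Γ, (N.initState).F Γ = [⟨⊥, N.init Γ, 0⟩] := fun Γ => rfl
  have hget : ∀ Γ (n : ℕ) a, ((N.initState).F Γ)[n]? = some a → n = 0 ∧ a = ⟨⊥, N.init Γ, 0⟩ := by
    intro Γ n a ha
    rw [hF] at ha
    cases n with
    | zero => simpa using ha.symm
    | succ n => simp at ha
  refine ⟨le_rfl, fun Γ => by simp [hF], fun Γ n a ha => ?_, fun Γ n a ha => ?_,
    fun Γ n a ha hat => ?_, fun p => .inl rfl, fun p => List.Pairwise.nil, fun p e he => (by cases he),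
    fun p t' _ => ?_⟩
  · obtain ⟨rfl, rfl⟩ := hget Γ n a ha
    exact hW.init Γ
  · obtain ⟨rfl, rfl⟩ := hget Γ n a ha
    exact bot_le
  · cases n with
    | zero => simp [hF]
    | succ n => exact absurd hat (not_lt.2 (hW.nonneg Γ n a ha))
  · obtain ⟨b, hb, hbt, hbx, hbo⟩ := shifter_get?_of (c := N.pinShift p) (hW.init (N.src p))
    have := PartState.succ_self (t := t') hb (by simp [hbt]) (by rw [hbo]; simp [Transition.occ])
    rw [hbx] at this
    exact this

theorem gateInv_initState (C : Chan) : GateInv W N.initState 0 C := by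
  by_cases hx : ((N.channel C).f fun I => N.init (N.src ⟨C, I⟩)) = N.init (.inr C)
  · have hgo : (N.initState).go C = ⟨N.init (.inr C), []⟩ := by
      simp [initState, Driver.value, hx]
    refine ⟨.inl (by rw [hgo]), by rw [hgo]; rfl, .inl ?_⟩
    rw [hgo]
    exact hx.symm
  · have hgo : (N.initState).go C = Driver.sched ⟨N.init (.inr C), []⟩ 0
        ((N.channel C).f fun I => N.init (N.src ⟨C, I⟩)) := by
      simp [initState, Driver.value, hx]
    refine ⟨.inr ⟨_, by rw [hgo]; rfl⟩, by rw [hgo]; rfl, .inl ?_⟩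
    rw [hgo, Driver.value_sched_of_le _ _ le_rfl]
    rfl

/-! ### Termination -/

/-- The termination measure, where `K Γ` bounds the length of the file of `Γ`. -/
def size [Fintype Inp] [Fintype Chan] (K : Inp ⊕ Chan → ℕ) (st : N.SimState) :
    ℕ ×ₗ ℕ ×ₗ ℕ ×ₗ ℕ :=
  toLex (∑ Γ, (K Γ - (st.F Γ).length), toLex (∑ p, (st.ti p).pend.length,
    toLex (∑ p, (st.gi p).pend.length, ∑ C, (st.go C).pend.length)))

theorem _root_.Fintype.sum_lt_sum_of_eq_of_ne {ι : Type*} [Fintype ι] {f g : ι → ℕ} (i : ι)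
    (h : ∀ j, j ≠ i → f j = g j) (hi : f i < g i) : ∑ j, f j < ∑ j, g j := by
  refine Finset.sum_lt_sum (fun j _ => ?_) ⟨i, Finset.mem_univ i, hi⟩
  by_cases e : j = i
  · exact e ▸ hi.le
  · exact (h j e).le

theorem Progress.size_lt [Fintype Inp] [Fintype Chan] {K : Inp ⊕ Chan → ℕ} (h : Progress st st')
    (hK : ∀ Γ, (st'.F Γ).length ≤ K Γ) : size K st' < size K st := by
  unfold size
  rcases h with ⟨Γ, h1, h2⟩ | ⟨hF, ⟨p, h1, h2⟩ | ⟨hti, ⟨p, h1, h2⟩ | ⟨hgi, C, h1, h2⟩⟩⟩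
  · refine Prod.Lex.toLex_lt_toLex.2 (.inl ?_)
    refine Fintype.sum_lt_sum_of_eq_of_ne Γ (fun Γ' hΓ => by rw [h1 Γ' hΓ]) ?_
    -- The subtraction is truncated; it decreases strictly because even the new length is within the
    -- bound.
    have := hK Γ
    omega
  · rw [hF]
    refine Prod.Lex.toLex_lt_toLex.2 (.inr ⟨rfl, Prod.Lex.toLex_lt_toLex.2 (.inl ?_)⟩)
    exact Fintype.sum_lt_sum_of_eq_of_ne p (fun q hq => by rw [h1 q hq]) h2
  · rw [hF, hti]
    refine Prod.Lex.toLex_lt_toLex.2 (.inr ⟨rfl, Prod.Lex.toLex_lt_toLex.2 (.inr ⟨rfl,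
      Prod.Lex.toLex_lt_toLex.2 (.inl ?_)⟩)⟩)
    exact Fintype.sum_lt_sum_of_eq_of_ne p (fun q hq => by rw [h1 q hq]) h2
  · rw [hF, hti, hgi]
    refine Prod.Lex.toLex_lt_toLex.2 (.inr ⟨rfl, Prod.Lex.toLex_lt_toLex.2 (.inr ⟨rfl,
      Prod.Lex.toLex_lt_toLex.2 (.inr ⟨rfl, ?_⟩)⟩)⟩)
    exact Fintype.sum_lt_sum_of_eq_of_ne C (fun D hD => by rw [h1 D hD]) h2

theorem Inv.length_le (h : Inv W τ st) {Γ : Inp ⊕ Chan} {k : ℕ}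
    (hk : ∀ n (a : Transition), (W Γ).get? n = some a → (a.t ≤ (τ : WithBot ℝ) ↔ n < k)) :
    (st.F Γ).length ≤ k := by
  obtain ⟨t, htτ, h, -⟩ := h
  have hpos := h.pos Γ
  have ha : (st.F Γ)[(st.F Γ).length - 1]? = some ((st.F Γ)[(st.F Γ).length - 1]) :=
    List.getElem?_eq_getElem _
  have := (hk _ _ (h.pre _ _ _ ha)).1 ((h.le _ _ _ ha).trans (by exact_mod_cast htτ))
  omega

/-- Files contain only transitions of `W` scheduled up to `τ`, and `W` has finitely many of them.
Every event either adds one, or uses up a pending transition and creates new ones only in a later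
component of the lexicographic measure. -/
theorem Inv.acc [Finite Inp] [Finite Chan] (hN : N.Supported) (hW : N.IsSignals u ε W)
    (hm : N.MapsTo W W) (hε : 0 < ε) (h : Inv W τ st) :
    Acc (fun st' st => N.Step u τ st st') st := by
  have := Fintype.ofFinite Inp
  have := Fintype.ofFinite Chan
  choose K _ hK using fun Γ => (hW.tct Γ).exists_count τ
  induction hs : size K st using WellFoundedLT.induction generalizing st with
  | ind m ih =>
    refine Acc.intro st fun st' hstep => ?_
    obtain ⟨h', hp⟩ := Step.inv hN hW hm hε h hstep
    exact ih _ (hs ▸ hp.size_lt fun Γ => h'.length_le (hK Γ)) h' rfl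

/-! ### Terminated runs -/

instance [Finite Inp] [Finite Chan] : Finite N.Event := by
  let f : N.Event → Inp ⊕ N.Pin ⊕ N.Pin ⊕ Chan := fun
    | .ext i => .inl i
    | .ti p => .inr (.inl p)
    | .gi p => .inr (.inr (.inl p))
    | .go C => .inr (.inr (.inr C))
  refine Finite.of_injective f fun a b h => ?_
  cases a <;> cases b <;> simp_all [f]

theorem Due.unique {ev : N.Event} {s s' : ℝ} (h : N.Due u st ev s) (h' : N.Due u st ev s') :
    s = s' := by
  cases ev with
  | ext i =>
    obtain ⟨a, ha, hs⟩ := h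
    obtain ⟨b, hb, hs'⟩ := h'
    rw [ha] at hb
    cases hb
    rw [hs] at hs'
    exact_mod_cast hs'
  | ti p => exact Option.some.inj (h.symm.trans h')
  | gi p => exact Option.some.inj (h.symm.trans h')
  | go C => exact Option.some.inj (h.symm.trans h')

/-- The main loop goes on as long as an event is due. -/
theorem exists_step [Finite Inp] [Finite Chan] {ev : N.Event} {s : ℝ} (h : N.Due u st ev s)
    (hs : s ≤ τ) : ∃ st', N.Step u τ st st' := by
  classical
  let time : N.Event → ℝ := fun ev => if h : ∃ s, N.Due u st ev s then h.choose else 0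
  have htime : ∀ ev s, N.Due u st ev s → time ev = s := by
    intro ev s h
    have hex : ∃ s, N.Due u st ev s := ⟨s, h⟩
    simp only [time, dif_pos hex]
    exact hex.choose_spec.unique h
  let A : Set N.Event := {ev | ∃ s, N.Due u st ev s}
  -- There are finitely many events, so one that is first by time and rank exists. The default value
  -- of `time` plays no role on `A`.
  obtain ⟨e, ⟨r, hr⟩, hmin⟩ := Set.exists_min_image A
    (fun ev => (toLex (time ev, ev.rank) : ℝ ×ₗ ℕ)) A.toFinite ⟨ev, s, h⟩
  have hmin' : ∀ ev' s', N.Due u st ev' s' → r < s' ∨ (r = s' ∧ e.rank ≤ ev'.rank) := by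
    intro ev' s' h'
    have := Prod.Lex.toLex_le_toLex.1 (hmin ev' ⟨s', h'⟩)
    simpa only [htime _ _ hr, htime _ _ h'] using this
  refine ⟨_, e, r, hr, ?_, hmin', rfl⟩
  rcases hmin' ev s h with e | e
  · exact e.le.trans hs
  · exact e.1.le.trans hs

theorem Inv.isUpTo [Finite Inp] [Finite Chan] (hW : N.IsSignals u ε W) (hm : N.MapsTo W W)
    (hε : 0 < ε) (h : Inv W τ st) (hfinal : ∀ st', ¬ N.Step u τ st st') (Γ : Inp ⊕ Chan) :
    IsUpTo τ (W Γ) (st.F Γ) := by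
  obtain ⟨t, htτ, h, hg⟩ := h
  intro n a
  refine ⟨fun ha => ⟨h.pre Γ n a ha, (h.le Γ n a ha).trans (by exact_mod_cast htτ)⟩, ?_⟩
  rintro ⟨ha, hat⟩
  have hn := h.lt_length hW hm hε hg htτ (fun ev s hd => not_le.1 fun hs =>
    (exists_step hd hs).elim hfinal) Γ n a ha hat
  rw [List.getElem?_eq_getElem hn, ← ha, h.pre Γ n _ (List.getElem?_eq_getElem hn)]

theorem Inv.of_reflTransGen [Finite Chan] (hN : N.Supported) (hW : N.IsSignals u ε W)
    (hm : N.MapsTo W W) (hε : 0 < ε) (h : Inv W τ st)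
    (hr : Relation.ReflTransGen (N.Step u τ) st st') : Inv W τ st' := by
  induction hr with
  | refl => exact h
  | tail _ hs ih => exact (Step.inv hN hW hm hε ih hs).1

/-! ### Executions -/

variable (N) in
/-- The signals of all vertices, given those of input ports and channels. -/
def vertexSignal (W : Inp ⊕ Chan → TCTSeq) : Vertex Inp Out Chan → TCTSeq
  | .inp i => W (.inl i)
  | .out o => W (N.outSrc o)
  | .chan C => W (.inr C)

theorem vertexSignal_toVertex (W : Inp ⊕ Chan → TCTSeq) (Γ : Inp ⊕ Chan) :
    N.vertexSignal W (toVertex Γ) = W Γ := by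
  cases Γ <;> rfl

theorem IsSignals.isExecution (hW : N.IsSignals u ε W) (hm : N.MapsTo W W) :
    N.IsExecution (N.vertexSignal W) where
  tct
    | .inp i => hW.tct _
    | .out o => hW.tct _
    | .chan C => hW.tct _
  out o := by rw [vertexSignal_toVertex]; rfl
  chan C := by
    simp only [vertexSignal_toVertex]
    exact hm C

theorem IsExecution.eq_vertexSignal {E : Vertex Inp Out Chan → TCTSeq} (hE : N.IsExecution E) :
    E = N.vertexSignal fun Γ => E (toVertex Γ) := by
  funext Γ
  cases Γ with
  | inp i => rfl
  | out o => exact hE.out o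
  | chan C => rfl

end Circuit
end CIDM

end

theorem theorem3 {Inp Out Chan : Type*} [Finite Inp] [Finite Chan]
    (N : CIDM.Circuit Inp Out Chan) (hN : N.Supported) (hcomp : N.Compatible)
    (u : Inp → CIDM.TCTSeq) (hu : N.AdmissibleInput u) (τ : ℝ) (hτ : 0 ≤ τ) :
    -- there is no infinite run
    Acc (fun st' st => N.Step u τ st st') N.initState ∧
    ∃ E : CIDM.Vertex Inp Out Chan → CIDM.TCTSeq,
      -- `E` is the unique execution with the given input signals
      (N.IsExecution E ∧ ∀ i, E (.inp i) = u i) ∧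
      (∀ E', N.IsExecution E' → (∀ i, E' (.inp i) = u i) → E' = E) ∧
      -- every terminated run has recorded `E` up to time `τ`
      ∀ st, Relation.ReflTransGen (N.Step u τ) N.initState st →
        (∀ st', ¬ N.Step u τ st st') →
        ∀ Γ, CIDM.IsUpTo τ (E Γ) (st.recorded Γ) := by
  obtain ⟨ε, hε, hmargin⟩ := hcomp.exists_margin
  obtain ⟨W, hW, hm⟩ := CIDM.Circuit.exists_fixedPoint hu hε hmargin
  have hstart : CIDM.Circuit.Inv W τ N.initState :=
    ⟨0, hτ, CIDM.Circuit.simInv_initState hW, CIDM.Circuit.gateInv_initState⟩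
  refine ⟨hstart.acc hN hW hm hε, N.vertexSignal W, ⟨hW.isExecution hm, hW.inl⟩,
    fun E' hE' hE'u => ?_, fun st hr hfinal Γ => ?_⟩
  -- Any execution is a fixed point that automatically has the margin `ε`, so uniqueness of fixed
  -- points applies to it.
  · have hW' := CIDM.Circuit.isSignals_of_maps hu hmargin
      (W := fun Γ => E' (CIDM.Circuit.toVertex Γ)) hE'u fun C => ⟨_, hE'.chan C⟩
    rw [hE'.eq_vertexSignal, CIDM.Circuit.MapsTo.unique hε hW' hW hE'.chan hm]
  · have h := (hstart.of_reflTransGen hN hW hm hε hr).isUpTo hW hm hε hfinal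
    cases Γ with
    | inp i => exact h _
    | out o => exact h _
    | chan C => exact h _
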